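/- All graphs are finite and loopless. For a multigraph $G$ and a family $\mathcal F$ of graphs, $G$ is $\mathcal F$-free if no subgraph of $G$ is isomorphic to a member of $\mathcal F$; $\mathrm{ex}(G,\mathcal F)$ is the maximum number of edges of an $\mathcal F$-free spanning subgraph of $G$; and $\mathrm{KG}(G,\mathcal F)$ is the graph whose vertices are the edge sets of the subgraphs of $G$ isomorphic to a member of $\mathcal F$, two of them being adjacent if they are disjoint. For a hypergraph $\mathcal K$ with finite vertex set and nonempty hyperedges, $\mathrm{KG}(\mathcal K)$ is the graph whose vertices are the hyperedges of $\mathcal K$, adjacent if disjoint. For $X\in\{-1,0,+1\}^n\setminus\{0\}$ let $\mathrm{alt}(X)$ be the length of a longest subsequence of nonzero terms of $X$ in which consecutive terms are distinct. For a linear ordering $\sigma=(v_1,\dots,v_n)$ of $V(\mathcal K)$ put $X_\sigma^{\pm}=\{v_j: x_j=\pm1\}$, and let $\mathrm{alt}_\sigma(\mathcal K)$ (respectively $\mathrm{salt}_\sigma(\mathcal K)$) be the largest value of $\mathrm{alt}(X)$ over all $X\ne 0$ for which neither (respectively at most one) of $X^+_\sigma$, $X^-_\sigma$ contains a hyperedge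 of $\mathcal K$, with value $0$ if there is no such $X$. Let $\mathrm{alt}(\mathcal K)=\min_\sigma \mathrm{alt}_\sigma(\mathcal K)$ and $\mathrm{salt}(\mathcal K)=\min_\sigma \mathrm{salt}_\sigma(\mathcal K)$. For a graph $\Gamma$ let $$\zeta(\Gamma)=\max_{\mathcal K}\bigl(|V(\mathcal K)|-\mathrm{alt}(\mathcal K)\bigr),\qquad \zeta_s(\Gamma)=\max_{\mathcal K}\bigl(|V(\mathcal K)|+1-\mathrm{salt}(\mathcal K)\bigr),$$ where the maxima are over all such $\mathcal K$ with $\mathrm{KG}(\mathcal K)\cong\Gamma$. **Theorem.** Let $H$ be a simple graph, let $\mathcal F$ be a family of subgraphs of $H$, let $r\ge 2$, and let $G$ be the multigraph obtained from $H$ by giving multiplicity $r$ to the edges in some set $S\subseteq E(H)$ (all other edges keeping multiplicity $1$). Suppose that the spanning subgraph $(V(H),S)$ of $H$ has an $\mathcal F$-free spanning subgraph with $\mathrm{ex}(H,\mathcal F)$ edges. Then $$\chi(\mathrm{KG}(G,\mathcal F))=\zeta(\mathrm{KG}(G,\mathcal F))=|E(G)|-\mathrm{ex}(G,\mathcal F).$$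 If moreover $r$ is even and $\mathcal F\neq\varnothing$, then also $$\chi(\mathrm{KG}(G,\mathcal F))=\zeta_s(\mathrm{KG}(G,\mathcal F)).$$ -/

import Mathlib

/-! ### Multigraphs: isomorphism, free subgraphs, generalized Turán number -/

namespace Graph

/-- Two (multi)graphs are isomorphic: there are bijections of the vertices and of the edges which
preserve and reflect incidence. -/
def IsIsomorphicTo {α α' β β' : Type*} (K : Graph α β) (F : Graph α' β') : Prop :=
  ∃ (φ : K.vertexSet ≃ F.vertexSet) (ψ : K.edgeSet ≃ F.edgeSet),
    ∀ (e : K.edgeSet) (x y : K.vertexSet),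
      K.IsLink (e : β) (x : α) (y : α) ↔ F.IsLink (ψ e : β') (φ x : α') (φ y : α')

/-- `G` is `𝓕`-free: no subgraph of `G` is isomorphic to a member of `𝓕`. -/
def IsFreeOf {α α' β β' : Type*} (G : Graph α β) (𝓕 : Set (Graph α' β')) : Prop :=
  ∀ K : Graph α β, K ≤ G → ∀ F ∈ 𝓕, ¬ K.IsIsomorphicTo F

/-- The generalized Turán number `ex(G, 𝓕)` of a finite multigraph `G`: the maximum number of
edges of an `𝓕`-free spanning subgraph of `G`. -/
noncomputable def turanNumber {α α' β β' : Type*} (G : Graph α β) (𝓕 : Set (Graph α' β')) : ℕ :=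
  sSup {m : ℕ | ∃ K : Graph α β, K ≤s G ∧ K.IsFreeOf 𝓕 ∧ K.edgeSet.ncard = m}

/-- The hypergraph `(G choose 𝓕)`: its vertices are the edges of `G`, and its hyperedges are the
(nonempty) edge sets of the subgraphs of `G` that are isomorphic to a member of `𝓕`. -/
def copyHypergraph {α α' β β' : Type*} (G : Graph α β) (𝓕 : Set (Graph α' β')) :
    Hypergraph β where
  vertexSet := G.edgeSet
  edgeSet := {A : Set β | A.Nonempty ∧
    ∃ K : Graph α β, K ≤ G ∧ (∃ F ∈ 𝓕, K.IsIsomorphicTo F) ∧ K.edgeSet = A}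
  subset_vertexSet_of_mem_edgeSet' := by
    rintro _ ⟨-, K, hK, -, rfl⟩
    exact IsSubgraph.edgeSet_mono hK

/-- `G` is obtained from the simple graph `H` by giving multiplicity `r` to the edges in `S`, all
other edges of `H` keeping multiplicity one. -/
structure IsMultiplied {α β γ : Type*} (G : Graph α γ) (H : Graph α β) (S : Set β) (r : ℕ) :
    Prop where
  subset_edgeSet : S ⊆ H.edgeSet
  vertexSet_eq : G.vertexSet = H.vertexSet
  adj_of_isLink : ∀ (f : γ) (x y : α), G.IsLink f x y → H.Adj x y
  encard_of_mem : ∀ (e : β) (x y : α), H.IsLink e x y → e ∈ S →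
    {f : γ | G.IsLink f x y}.encard = (r : ℕ∞)
  encard_of_notMem : ∀ (e : β) (x y : α), H.IsLink e x y → e ∉ S →
    {f : γ | G.IsLink f x y}.encard = 1

end Graph

/-! ### Signed vectors and alternating subsequences -/

/-- `alt(X)`: the length of a longest alternating subsequence of nonzero terms of
`X ∈ {-1, 0, +1}ⁿ`. -/
noncomputable def alternationLength {n : ℕ} (X : Fin n → SignType) : ℕ :=
  sSup {m : ℕ | ∃ j : Fin m → Fin n, StrictMono j ∧ (∀ i, X (j i) ≠ 0) ∧
    ∀ i i' : Fin m, (i : ℕ) + 1 = (i' : ℕ) → X (j i) ≠ X (j i')}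

namespace Hypergraph

/-! ### Kneser graphs and (strong) altermatic numbers -/

/-- The general Kneser graph `KG(H)`: its vertices are the hyperedges of `H`, two of them being
adjacent if they are disjoint. -/
def kneserGraph {α : Type*} (H : Hypergraph α) : SimpleGraph H.edgeSet where
  Adj A B := A ≠ B ∧ Disjoint (A : Set α) (B : Set α)
  symm := ⟨fun _ _ h => ⟨h.1.symm, h.2.symm⟩⟩
  loopless := ⟨fun _ h => h.1 rfl⟩

/-- For an ordering `σ` of the vertices of `H`, a sign `s` and a vector `X`, the set of the
vertices that receive the sign `s`: `X⁺_σ` for `s = 1` and `X⁻_σ` for `s = -1`. -/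
def signClass {α : Type*} {H : Hypergraph α} {n : ℕ} (σ : Fin n ≃ H.vertexSet)
    (X : Fin n → SignType) (s : SignType) : Set α :=
  {v : α | ∃ j : Fin n, X j = s ∧ (σ j : α) = v}

/-- `U` contains some hyperedge of `H`. -/
def ContainsEdge {α : Type*} (H : Hypergraph α) (U : Set α) : Prop :=
  ∃ A ∈ H.edgeSet, A ⊆ U

/-- `alt_σ(H)`: the largest `alt(X)`, over nonzero `X`, such that neither `X⁺_σ` nor `X⁻_σ`
contains a hyperedge of `H` (and `0` if there is no such `X`). -/
noncomputable def altOrd {α : Type*} {H : Hypergraph α} {n : ℕ} (σ : Fin n ≃ H.vertexSet) : ℕ :=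
  sSup {k : ℕ | ∃ X : Fin n → SignType, X ≠ 0 ∧ alternationLength X = k ∧
    ¬ H.ContainsEdge (signClass σ X 1) ∧ ¬ H.ContainsEdge (signClass σ X (-1))}

/-- `salt_σ(H)`: the largest `alt(X)`, over nonzero `X`, such that at most one of `X⁺_σ` and
`X⁻_σ` contains a hyperedge of `H`. -/
noncomputable def saltOrd {α : Type*} {H : Hypergraph α} {n : ℕ} (σ : Fin n ≃ H.vertexSet) : ℕ :=
  sSup {k : ℕ | ∃ X : Fin n → SignType, X ≠ 0 ∧ alternationLength X = k ∧
    ¬ (H.ContainsEdge (signClass σ X 1) ∧ H.ContainsEdge (signClass σ X (-1)))}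

/-- `alt(H)`: the minimum of `alt_σ(H)` over the linear orderings `σ` of the vertices. -/
noncomputable def alt {α : Type*} (H : Hypergraph α) : ℕ :=
  sInf (Set.range fun σ : Fin H.vertexSet.ncard ≃ H.vertexSet => altOrd σ)

/-- `salt(H)`: the minimum of `salt_σ(H)` over the linear orderings `σ` of the vertices. -/
noncomputable def salt {α : Type*} (H : Hypergraph α) : ℕ :=
  sInf (Set.range fun σ : Fin H.vertexSet.ncard ≃ H.vertexSet => saltOrd σ)

/-- `H` is a Kneser representation of `G`: it is finite, its hyperedges are nonempty, and `KG(H)`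
is isomorphic to `G`. -/
def IsKneserRepresentation {α W : Type*} (H : Hypergraph α) (G : SimpleGraph W) : Prop :=
  H.vertexSet.Finite ∧ ∅ ∉ H.edgeSet ∧ Nonempty (H.kneserGraph ≃g G)

end Hypergraph

namespace SimpleGraph

/-- The altermatic number `ζ(G)`, the maximum of `|V(H)| - alt(H)` over all Kneser
representations `H` of `G`. Up to isomorphism the vertices of `H` are natural numbers; the
subtraction does not truncate since `alt(H) ≤ |V(H)|`, and a supremum in `ℕ∞` which is finite
is attained. -/
noncomputable def altermaticNumber {W : Type*} (G : SimpleGraph W) : ℕ∞ :=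
  ⨆ (H : Hypergraph ℕ) (_ : H.IsKneserRepresentation G),
    ((H.vertexSet.ncard - H.alt : ℕ) : ℕ∞)

/-- The strong altermatic number `ζ_s(G)`, the maximum of `|V(H)| + 1 - salt(H)` over all Kneser
representations `H` of `G`. -/
noncomputable def strongAltermaticNumber {W : Type*} (G : SimpleGraph W) : ℕ∞ :=
  ⨆ (H : Hypergraph ℕ) (_ : H.IsKneserRepresentation G),
    ((H.vertexSet.ncard + 1 - H.salt : ℕ) : ℕ∞)

end SimpleGraph

namespace Graph

/-- `KG(G, 𝓕)`: the Kneser graph of the hypergraph `(G choose 𝓕)`. -/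
abbrev kneserGraphOf {α α' β β' : Type*} (G : Graph α β) (𝓕 : Set (Graph α' β')) :
    SimpleGraph (G.copyHypergraph 𝓕).edgeSet :=
  (G.copyHypergraph 𝓕).kneserGraph

end Graph

/-! All the quantities lie in one cycle of inequalities, with $e=\mathrm{ex}(H,\mathcal F)$ and with
$\mathrm{alt}_\sigma$ taken for the hypergraph of copies in $G$: $|E(G)|-\mathrm{ex}(G,\mathcal
F)\le|E(G)|-re\le|E(G)|-\mathrm{alt}_\sigma\le\zeta\le\chi\le|E(G)|-\mathrm{ex}(G,\mathcal F)$.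

The last inequality colours each copy by one of its edges outside a largest free subgraph. The first
holds because the preimage in $G$ of the free subgraph of $(V(H),S)$ is free and has $re$ edges
(`IsMultiplied.mul_turanNumber_le`).

For the second, $\sigma$ lists parallel edges consecutively, so that they form blocks of size at
most $r$. A sign class without a copy projects to a free subgraph of $H$, hence meets at most $e$
blocks. A block met by one sign only contributes at most one term to an alternating sequence, and a
block met by both at most $r$, which gives $re$ in all (`length_le_of_blocks`). If only one sign
class is known to have no copy and $r$ is even, that class supplies at most $re/2$ terms, so the
sequence has length at most $re+1$; this handles $\zeta_s$.

The topological input is $\zeta\le\chi$ and, for graphs with a vertex, $\zeta_s\le\chi$. A proper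
colouring labels the signed vectors of long alternation by colours, the remaining ones are labelled
by alternation length and first sign, and the octahedral Tucker lemma bounds the dimension by the
number of labels. That lemma follows from Ky Fan's parity count of alternating maximal chains. -/

/-! ### The octahedral Tucker lemma -/

/-- The indicator, modulo two, of the lists of signs that alternate and start with `b`. -/
def alternatingIndicator : Bool → List Bool → ZMod 2
  | _, [] => 1
  | b, x :: l => if x = b then alternatingIndicator (!b) l else 0

/-- A list that does not alternate can be repaired by one deletion only at its sole pair of equal
neighbours; both deletions work and cancel modulo two. An alternating list of length at least two
survives only the deletion of an end, and exactly one of the two ends leaves the first sign `b`. -/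
theorem sum_alternatingIndicator_eraseIdx (b : Bool) (l : List Bool) :
    ∑ i : Fin l.length, alternatingIndicator b (l.eraseIdx i) =
      alternatingIndicator true l + alternatingIndicator false l := by
  induction l generalizing b with
  | nil => simpa [alternatingIndicator] using (CharTwo.add_self_eq_zero (1 : ZMod 2)).symm
  | cons x l ih =>
    have h : ∑ i : Fin (x :: l).length, alternatingIndicator b ((x :: l).eraseIdx i) =
        alternatingIndicator b l +
          ∑ i : Fin l.length, alternatingIndicator b (x :: l.eraseIdx i) := by
      simpa using Fin.sum_univ_succ
        (fun i : Fin (l.length + 1) => alternatingIndicator b ((x :: l).eraseIdx i))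
    rw [h]
    by_cases hx : x = b
    · subst hx
      simp only [alternatingIndicator, if_true, ih]
      cases x <;> simp <;> ring_nf <;> simp [CharTwo.two_eq_zero]
    · have hx' : b = !x := by cases x <;> cases b <;> simp_all
      subst hx'
      cases x <;> simp [alternatingIndicator]

theorem alternatingIndicator_map_not (b : Bool) (l : List Bool) :
    alternatingIndicator b (l.map (!·)) = alternatingIndicator (!b) l := by
  induction l generalizing b with
  | nil => rfl
  | cons x l ih => cases x <;> cases b <;> simp [alternatingIndicator, ih]

/-- The indicator of the multisets of signed labels whose signs alternate, starting with `b`,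
when the labels are sorted. -/
def sortedIndicator (b : Bool) (M : Multiset (ℕ ×ₗ Bool)) : ZMod 2 :=
  alternatingIndicator b ((M.sort (· ≤ ·)).map fun x => (ofLex x).2)

theorem sum_sortedIndicator_erase (b : Bool) (M : Multiset (ℕ ×ₗ Bool)) :
    (M.map fun a => sortedIndicator b (M.erase a)).sum =
      sortedIndicator true M + sortedIndicator false M := by
  obtain ⟨l, hl⟩ : ∃ l, M.sort (· ≤ ·) = l := ⟨_, rfl⟩
  have hM : M = (l : Multiset (ℕ ×ₗ Bool)) := by rw [← hl, M.sort_eq]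
  have hs : l.Pairwise (· ≤ ·) := hl ▸ M.pairwise_sort _
  have hfac (i : Fin l.length) : (M.erase l[i]).sort (· ≤ ·) = l.eraseIdx i := by
    refine List.Perm.eq_of_pairwise (le := (· ≤ ·)) (fun _ _ _ _ => le_antisymm)
      (Multiset.pairwise_sort _ _) (hs.eraseIdx _) ?_
    rw [← Multiset.coe_eq_coe, Multiset.sort_eq, hM, Multiset.coe_erase, Multiset.coe_eq_coe]
    exact @List.erase_getElem _ instBEqOfDecidableEq _ l i i.2
  calc (M.map fun a => sortedIndicator b (M.erase a)).sum
      = (l.map fun a => sortedIndicator b (M.erase a)).sum := by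
        rw [← Multiset.sum_coe, ← Multiset.map_coe, ← hM]
    _ = ∑ i : Fin l.length, sortedIndicator b (M.erase l[i]) := by
        rw [← List.sum_ofFn, List.ofFn_eq_map]
        conv_lhs => rw [← List.map_getElem_finRange l]
        rw [List.map_map]; rfl
    _ = ∑ i : Fin (l.map fun x => (ofLex x).2).length,
          alternatingIndicator b ((l.map fun x => (ofLex x).2).eraseIdx i) := by
        refine Fintype.sum_equiv (finCongr (by simp)) _ _ fun i => ?_
        rw [sortedIndicator, hfac]
        simp [List.eraseIdx_map]
    _ = _ := by rw [sum_alternatingIndicator_eraseIdx, sortedIndicator, sortedIndicator, hl]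

/-- The sign vector of a Boolean. -/
def Bool.toSignType (b : Bool) : SignType := if b then 1 else -1

/-- The members of a maximal chain of nonzero sign vectors, the largest one being `s`; the
coordinate `v` vanishes from the index `p v + 1` on. -/
def signFlag {n : ℕ} (p : Equiv.Perm (Fin n)) (s : Fin n → Bool) (i v : Fin n) : SignType :=
  if i ≤ p v then (s v).toSignType else 0

theorem signFlag_ne_zero {n : ℕ} (p : Equiv.Perm (Fin n)) (s : Fin n → Bool) (i : Fin n) :
    signFlag p s i ≠ 0 := by
  intro h
  have := congrFun h (p.symm i)
  cases hs : s (p.symm i) <;> simp [signFlag, Bool.toSignType, hs] at this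

theorem signFlag_not {n : ℕ} (p : Equiv.Perm (Fin n)) (s : Fin n → Bool) (i : Fin n) :
    signFlag p (fun v => !s v) i = -signFlag p s i := by
  ext v
  cases hs : s v <;> by_cases h : i ≤ p v <;> simp [signFlag, Bool.toSignType, hs, h]

/-- `X ⊑ Y` for sign vectors: `Y` agrees with `X` on the support of `X`. -/
def SignLE {n : ℕ} (X Y : Fin n → SignType) : Prop := ∀ v, X v ≠ 0 → Y v = X v

theorem signFlag_signLE {n : ℕ} (p : Equiv.Perm (Fin n)) (s : Fin n → Bool) {i j : Fin n}
    (h : i ≤ j) : SignLE (signFlag p s j) (signFlag p s i) := by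
  intro v hv
  have : j ≤ p v := by
    by_contra hj
    simp [signFlag, hj] at hv
  simp [signFlag, this, h.trans this]

/-- A labelling of the nonzero sign vectors that is antisymmetric and has no complementary
comparable pair. -/
structure IsTuckerLabelling {n : ℕ} (lam : (Fin n → SignType) → ℕ ×ₗ Bool) : Prop where
  neg : ∀ X, X ≠ 0 → lam (-X) = toLex ((ofLex (lam X)).1, !(ofLex (lam X)).2)
  snd_eq : ∀ X Y, X ≠ 0 → Y ≠ 0 → SignLE X Y → (ofLex (lam X)).1 = (ofLex (lam Y)).1 →
    (ofLex (lam X)).2 = (ofLex (lam Y)).2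

section

variable {n : ℕ} (lam : (Fin n → SignType) → ℕ ×ₗ Bool)

/-- The labels of a maximal chain. -/
def flagLabels (p : Equiv.Perm (Fin n)) (s : Fin n → Bool) : Multiset (ℕ ×ₗ Bool) :=
  Finset.univ.val.map fun i => lam (signFlag p s i)

variable {lam}

theorem IsTuckerLabelling.eq_of_mem_flagLabels (h : IsTuckerLabelling lam)
    {p : Equiv.Perm (Fin n)} {s : Fin n → Bool} {x y : ℕ ×ₗ Bool} (hx : x ∈ flagLabels lam p s)
    (hy : y ∈ flagLabels lam p s) (hxy : (ofLex x).1 = (ofLex y).1) :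
    (ofLex x).2 = (ofLex y).2 := by
  simp only [flagLabels, Multiset.mem_map] at hx hy
  obtain ⟨i, -, rfl⟩ := hx
  obtain ⟨j, -, rfl⟩ := hy
  rcases le_total i j with hij | hij
  · exact (h.snd_eq _ _ (signFlag_ne_zero _ _ _) (signFlag_ne_zero _ _ _) (signFlag_signLE p s hij)
      hxy.symm).symm
  · exact h.snd_eq _ _ (signFlag_ne_zero _ _ _) (signFlag_ne_zero _ _ _) (signFlag_signLE p s hij) hxy

/-- Within a chain no index carries both signs, so the lexicographic order of the labels depends on
the indices alone and sorting commutes with flipping all signs. -/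
theorem IsTuckerLabelling.sortedIndicator_not (h : IsTuckerLabelling lam)
    (p : Equiv.Perm (Fin n)) (s : Fin n → Bool) (b : Bool) :
    sortedIndicator b (flagLabels lam p fun v => !s v) =
      sortedIndicator (!b) (flagLabels lam p s) := by
  have h1 : flagLabels lam p (fun v => !s v) =
      (flagLabels lam p s).map fun x => toLex ((ofLex x).1, !(ofLex x).2) := by
    simp only [flagLabels, Multiset.map_map]
    refine Multiset.map_congr rfl fun i _ => ?_
    rw [signFlag_not, h.neg _ (signFlag_ne_zero _ _ _)]
    rfl
  rw [sortedIndicator, h1, ← Multiset.map_sort (r := (· ≤ ·)), List.map_map, sortedIndicator,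
    ← alternatingIndicator_map_not, List.map_map]
  · rfl
  · intro x hx y hy
    have := h.eq_of_mem_flagLabels hx hy
    simp only [Prod.Lex.le_iff, ofLex_toLex]
    grind

end

section

variable {n : ℕ} (lam : (Fin (n + 1) → SignType) → ℕ ×ₗ Bool)

/-- The labels of a maximal chain with its `i`-th member removed. -/
def facetLabels (p : Equiv.Perm (Fin (n + 1))) (s : Fin (n + 1) → Bool) (i : Fin (n + 1)) :
    Multiset (ℕ ×ₗ Bool) :=
  Finset.univ.val.map fun j => lam (signFlag p s (i.succAbove j))

theorem sum_sortedIndicator_facetLabels (b : Bool) (p : Equiv.Perm (Fin (n + 1)))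
    (s : Fin (n + 1) → Bool) :
    ∑ i, sortedIndicator b (facetLabels lam p s i) =
      sortedIndicator true (flagLabels lam p s) + sortedIndicator false (flagLabels lam p s) := by
  rw [← sum_sortedIndicator_erase b]
  have (i : Fin (n + 1)) :
      facetLabels lam p s i = (flagLabels lam p s).erase (lam (signFlag p s i)) := by
    rw [flagLabels, Fin.univ_succAbove n i]
    simp [facetLabels, Function.comp_def]
  simp only [this]
  conv_rhs => rw [flagLabels, Multiset.map_map]
  rfl

/-- Only the threshold `k + 1` separates the values `k` and `k + 1` of `p`, so exchanging them
alters no other member of the chain: the two chains share this facet. -/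
theorem facetLabels_swap (p : Equiv.Perm (Fin (n + 1))) (s : Fin (n + 1) → Bool) (k : Fin n) :
    facetLabels lam (Equiv.swap k.castSucc k.succ * p) s k.succ = facetLabels lam p s k.succ := by
  refine Multiset.map_congr rfl fun j _ => congrArg lam ?_
  have hj : k.succ.succAbove j ≠ k.succ := Fin.succAbove_ne _ _
  generalize k.succ.succAbove j = i at hj
  ext v
  have : i ≤ Equiv.swap k.castSucc k.succ (p v) ↔ i ≤ p v := by
    rw [Equiv.swap_apply_def]
    split_ifs with h1 h2
    · rw [h1]; simp only [Fin.le_def, ne_eq, Fin.ext_iff, Fin.val_succ, Fin.val_castSucc] at *; omega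
    · rw [h2]; simp only [Fin.le_def, ne_eq, Fin.ext_iff, Fin.val_succ, Fin.val_castSucc] at *; omega
    · rfl
  simp [signFlag, this]

/-- Index `0` is the only member that sees the coordinate `p.symm 0`; once it is removed, the sign
there is free. -/
theorem facetLabels_update (p : Equiv.Perm (Fin (n + 1))) (s : Fin (n + 1) → Bool) (b : Bool) :
    facetLabels lam p (Function.update s (p.symm 0) b) 0 = facetLabels lam p s 0 := by
  refine Multiset.map_congr rfl fun j _ => congrArg lam ?_
  ext v
  by_cases hv : v = p.symm 0
  · simp [signFlag, hv]
  · simp only [signFlag, Function.update_of_ne hv]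

theorem facetLabels_decomposeFin (e : Equiv.Perm (Fin n)) (s : Fin n → Bool) (b : Bool) :
    facetLabels lam (Equiv.Perm.decomposeFin.symm (0, e)) (Fin.cons b s : Fin (n + 1) → Bool) 0 =
      flagLabels (fun X => lam (Fin.cons 0 X : Fin (n + 1) → SignType)) e s := by
  refine Multiset.map_congr rfl fun j _ => congrArg lam ?_
  ext v
  refine Fin.cases ?_ (fun w => ?_) v
  · simp [signFlag]
  · simp [signFlag]

theorem sum_sortedIndicator_facetLabels_succ (k : Fin n) :
    ∑ x : Equiv.Perm (Fin (n + 1)) × (Fin (n + 1) → Bool) with x.2 0 = true,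
      sortedIndicator true (facetLabels lam x.1 x.2 k.succ) = 0 := by
  refine Finset.sum_involution (fun x _ => (Equiv.swap k.castSucc k.succ * x.1, x.2)) ?_ ?_ ?_ ?_
  · intro x _
    rw [facetLabels_swap, CharTwo.add_self_eq_zero]
  · intro x _ _ hx
    have := congrArg (fun y => y.1) hx
    simp only [mul_eq_right, Equiv.swap_eq_one_iff] at this
    exact (Fin.castSucc_lt_succ (i := k)).ne this
  · simp
  · intro x _
    ext <;> simp

/-- Flipping the free sign pairs off these facets inside the hemisphere `x.2 0 = true`, unless the
free coordinate is `0` itself. Those exceptions lie on the equator and are the maximal chains one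
dimension lower. -/
theorem sum_sortedIndicator_facetLabels_zero :
    ∑ x : Equiv.Perm (Fin (n + 1)) × (Fin (n + 1) → Bool) with x.2 0 = true,
      sortedIndicator true (facetLabels lam x.1 x.2 0) =
    ∑ x : Equiv.Perm (Fin n) × (Fin n → Bool),
      sortedIndicator true
        (flagLabels (fun X => lam (Fin.cons 0 X : Fin (n + 1) → SignType)) x.1 x.2) := by
  rw [← Finset.sum_filter_add_sum_filter_not _
    (fun x : Equiv.Perm (Fin (n + 1)) × (Fin (n + 1) → Bool) => x.1 0 = 0)]
  have h2 : ∑ x ∈ {x : Equiv.Perm (Fin (n + 1)) × (Fin (n + 1) → Bool) | x.2 0 = true} with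
      ¬ x.1 0 = 0, sortedIndicator true (facetLabels lam x.1 x.2 0) = 0 := by
    refine Finset.sum_involution
      (fun x _ => (x.1, Function.update x.2 (x.1.symm 0) (!x.2 (x.1.symm 0)))) ?_ ?_ ?_ ?_
    · intro x _
      rw [facetLabels_update, CharTwo.add_self_eq_zero]
    · intro x _ _ hx
      have := congrFun (congrArg (fun y => y.2) hx) (x.1.symm 0)
      simp at this
    · intro x hx
      simp only [Finset.mem_filter, Finset.mem_univ, true_and] at hx ⊢
      refine ⟨?_, hx.2⟩
      rw [Function.update_of_ne, hx.1]
      intro h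
      exact hx.2 (by simpa using congrArg x.1 h)
    · intro x _
      ext <;> simp
  rw [h2, add_zero]
  symm
  refine Finset.sum_bij
    (fun x _ => (Equiv.Perm.decomposeFin.symm (0, x.1), (Fin.cons true x.2 : Fin (n + 1) → Bool)))
    ?_ ?_ ?_ ?_
  · simp
  · rintro ⟨e, s⟩ _ ⟨e', s'⟩ _ h
    simpa using h
  · rintro ⟨p, s⟩ hx
    simp only [Finset.mem_filter, Finset.mem_univ, true_and] at hx
    obtain ⟨⟨q, e⟩, rfl⟩ := Equiv.Perm.decomposeFin.symm.surjective p
    have hq : q = 0 := by simpa using hx.2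
    refine ⟨(e, Fin.tail s), Finset.mem_univ _, ?_⟩
    subst hq
    simp only [Prod.mk.injEq, true_and]
    rw [← hx.1, Fin.cons_self_tail]
  · rintro ⟨e, s⟩ _
    rw [facetLabels_decomposeFin]

theorem IsTuckerLabelling.cons_zero {lam : (Fin (n + 1) → SignType) → ℕ ×ₗ Bool}
    (h : IsTuckerLabelling lam) :
    IsTuckerLabelling fun X => lam (Fin.cons 0 X : Fin (n + 1) → SignType) := by
  have hne (X : Fin n → SignType) (hX : X ≠ 0) : (Fin.cons 0 X : Fin (n + 1) → SignType) ≠ 0 := by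
    intro h0
    exact hX (funext fun v => by simpa using congrFun h0 v.succ)
  constructor
  · intro X hX
    have : (Fin.cons 0 (-X) : Fin (n + 1) → SignType) = -Fin.cons 0 X := by
      ext v
      refine Fin.cases ?_ (fun w => ?_) v <;> simp
    simp only [this]
    exact h.neg _ (hne X hX)
  · intro X Y hX hY hXY
    refine h.snd_eq _ _ (hne X hX) (hne Y hY) fun v => ?_
    refine Fin.cases ?_ (fun w => ?_) v
    · simp
    · simpa using hXY w

end

/-- The combinatorial lemma of Ky Fan: the number of positive alternating maximal chains is odd. -/
theorem IsTuckerLabelling.sum_sortedIndicator {n : ℕ} {lam : (Fin n → SignType) → ℕ ×ₗ Bool}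
    (h : IsTuckerLabelling lam) :
    ∑ x : Equiv.Perm (Fin n) × (Fin n → Bool), sortedIndicator true (flagLabels lam x.1 x.2) =
      1 := by
  induction n with
  | zero => simp [flagLabels, sortedIndicator, alternatingIndicator]
  | succ n ih =>
    rw [← ih h.cons_zero, ← sum_sortedIndicator_facetLabels_zero,
      ← Finset.sum_filter_add_sum_filter_not _
        (fun x : Equiv.Perm (Fin (n + 1)) × (Fin (n + 1) → Bool) => x.2 0 = true)]
    have h1 : ∑ x : Equiv.Perm (Fin (n + 1)) × (Fin (n + 1) → Bool) with ¬ x.2 0 = true,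
        sortedIndicator true (flagLabels lam x.1 x.2) =
        ∑ x : Equiv.Perm (Fin (n + 1)) × (Fin (n + 1) → Bool) with x.2 0 = true,
          sortedIndicator false (flagLabels lam x.1 x.2) := by
      refine Finset.sum_nbij' (fun x => (x.1, fun v => !x.2 v)) (fun x => (x.1, fun v => !x.2 v))
        ?_ ?_ ?_ ?_ ?_
      · simp
      · simp
      · simp
      · simp
      · intro x _
        simp [h.sortedIndicator_not]
    -- The antipodal hemisphere has been folded onto the first one, so each chain there counts with
    -- both starting signs, which is the sum over its facets. Interior facets cancel and the equator
    -- remains.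
    rw [h1, ← Finset.sum_add_distrib]
    simp only [← sum_sortedIndicator_facetLabels lam true]
    rw [Finset.sum_comm, Fin.sum_univ_succ]
    simp [sum_sortedIndicator_facetLabels_succ]

theorem chain_ne_of_alternatingIndicator_ne_zero {b : Bool} {l : List Bool}
    (h : alternatingIndicator b l ≠ 0) : l.IsChain (· ≠ ·) := by
  induction l generalizing b with
  | nil => simp
  | cons x l ih =>
    have hx : x = b ∧ alternatingIndicator (!b) l ≠ 0 := by
      simpa [alternatingIndicator] using h
    cases l with
    | nil => simp
    | cons y l =>
      have hy : y = !b := by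
        by_contra hy
        simp [alternatingIndicator, hy] at hx
      refine List.isChain_cons_cons.2 ⟨?_, ih hx.2⟩
      rw [hx.1, hy]
      cases b <;> simp

/-- The octahedral Tucker lemma. -/
theorem IsTuckerLabelling.le {n m : ℕ} {lam : (Fin n → SignType) → ℕ ×ₗ Bool}
    (h : IsTuckerLabelling lam) (hm : ∀ X, X ≠ 0 → (ofLex (lam X)).1 < m) : n ≤ m := by
  obtain ⟨⟨p, s⟩, -, hx⟩ := Finset.exists_ne_zero_of_sum_ne_zero
    (h.sum_sortedIndicator.symm ▸ one_ne_zero :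
      ∑ x : Equiv.Perm (Fin n) × (Fin n → Bool),
        sortedIndicator true (flagLabels lam x.1 x.2) ≠ 0)
  have hc := chain_ne_of_alternatingIndicator_ne_zero hx
  set M := flagLabels lam p s with hM
  set l := M.sort (· ≤ ·) with hl
  have hs : l.IsChain (· ≤ ·) := (M.pairwise_sort _).isChain
  -- Equal neighbouring indices would force equal signs, against alternation; so the `n` indices of
  -- the chain are distinct.
  have hlt : (l.map fun x => (ofLex x).1).IsChain (· < ·) := by
    rw [List.isChain_map] at hc ⊢
    have hmem : ∀ x ∈ l, x ∈ M := fun x hx => (Multiset.mem_sort _).1 hx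
    rw [List.isChain_iff_getElem] at hc hs ⊢
    intro i hi
    have h1 := hc i hi
    have h2 := hs i hi
    have h3 := h.eq_of_mem_flagLabels (hmem _ (List.getElem_mem (n := i) (by omega)))
      (hmem _ (List.getElem_mem hi))
    rw [Prod.Lex.le_iff] at h2
    rcases h2 with h2 | h2
    · exact h2
    · exact absurd (h3 h2.1) h1
  have hnd : (l.map fun x => (ofLex x).1).Nodup := (List.isChain_iff_pairwise.1 hlt).imp ne_of_lt
  have hsub : (l.map fun x => (ofLex x).1).toFinset ⊆ Finset.range m := by
    intro k hk
    simp only [List.mem_toFinset, List.mem_map] at hk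
    obtain ⟨x, hx, rfl⟩ := hk
    have hx' := (Multiset.mem_sort _).1 hx
    simp only [hM, flagLabels, Multiset.mem_map] at hx'
    obtain ⟨i, -, rfl⟩ := hx'
    exact Finset.mem_range.2 (hm _ (signFlag_ne_zero _ _ _))
  have := Finset.card_le_card hsub
  rw [List.toFinset_card_of_nodup hnd, List.length_map, Finset.card_range, hl,
    Multiset.length_sort] at this
  simpa [hM, flagLabels] using this

/-! ### Alternating subsequences of sign vectors -/

/-- The positions `j` pick an alternating subsequence of nonzero terms of `X`. -/
def IsAlternating {n m : ℕ} (X : Fin n → SignType) (j : Fin m → Fin n) : Prop :=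
  StrictMono j ∧ (∀ i, X (j i) ≠ 0) ∧
    ∀ i i' : Fin m, (i : ℕ) + 1 = (i' : ℕ) → X (j i) ≠ X (j i')

section

variable {n m : ℕ} {X Y : Fin n → SignType} {j : Fin m → Fin n}

theorem IsAlternating.length_le (h : IsAlternating X j) : m ≤ n := by
  simpa using Fintype.card_le_of_injective j h.1.injective

theorem bddAbove_isAlternating (X : Fin n → SignType) :
    BddAbove {m : ℕ | ∃ j : Fin m → Fin n, IsAlternating X j} :=
  ⟨n, fun _ ⟨_, h⟩ => h.length_le⟩

theorem IsAlternating.le_alternationLength (h : IsAlternating X j) : m ≤ alternationLength X :=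
  le_csSup (bddAbove_isAlternating X) ⟨j, h⟩

theorem exists_isAlternating (X : Fin n → SignType) :
    ∃ j : Fin (alternationLength X) → Fin n, IsAlternating X j :=
  Nat.sSup_mem (s := {m : ℕ | ∃ j : Fin m → Fin n, IsAlternating X j})
    ⟨0, Fin.elim0, fun i => i.elim0, fun i => i.elim0, fun i => i.elim0⟩ (bddAbove_isAlternating X)

theorem alternationLength_le (X : Fin n → SignType) : alternationLength X ≤ n :=
  (exists_isAlternating X).choose_spec.length_le

theorem IsAlternating.neg (h : IsAlternating X j) : IsAlternating (-X) j :=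
  ⟨h.1, fun i => by simpa using h.2.1 i, fun i i' hi => by simpa using h.2.2 i i' hi⟩

theorem alternationLength_neg (X : Fin n → SignType) :
    alternationLength (-X) = alternationLength X := by
  apply le_antisymm
  · obtain ⟨j, hj⟩ := exists_isAlternating (-X)
    simpa using hj.neg.le_alternationLength
  · obtain ⟨j, hj⟩ := exists_isAlternating X
    exact hj.neg.le_alternationLength

theorem IsAlternating.mono (h : IsAlternating X j) (hXY : SignLE X Y) : IsAlternating Y j := by
  refine ⟨h.1, fun i => ?_, fun i i' hi => ?_⟩
  · rw [hXY _ (h.2.1 i)]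
    exact h.2.1 i
  · rw [hXY _ (h.2.1 i), hXY _ (h.2.1 i')]
    exact h.2.2 i i' hi

theorem alternationLength_pos (hX : X ≠ 0) : 0 < alternationLength X := by
  obtain ⟨v, hv⟩ := Function.ne_iff.1 hX
  have h : IsAlternating X (fun _ : Fin 1 => v) :=
    ⟨fun i i' h => absurd h (by simp [Subsingleton.elim i i']), fun _ => hv,
      fun i i' h => absurd h (by simp [Subsingleton.elim i i'])⟩
  exact h.le_alternationLength

theorem IsAlternating.cons {j : Fin (m + 1) → Fin n} (h : IsAlternating X j) {u : Fin n}
    (hu : u < j 0) (hu0 : X u ≠ 0) (hne : X u ≠ X (j 0)) :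
    IsAlternating X (Fin.cons u j : Fin (m + 2) → Fin n) := by
  refine ⟨strictMono_vecCons.2 ⟨hu, h.1⟩, ?_, ?_⟩
  · intro i
    refine Fin.cases ?_ (fun i => ?_) i
    · simpa using hu0
    · simpa using h.2.1 i
  · intro i i'
    refine Fin.cases ?_ (fun i => ?_) i <;> refine Fin.cases ?_ (fun i' => ?_) i'
    · simp
    · intro hi
      have : i' = 0 := by
        ext
        simpa using hi.symm
      simpa [this] using hne
    · simp
    · intro hi
      simpa using h.2.2 i i' (by simpa using hi)

/-- Some longest alternating subsequence of `X` starts with the sign `s`. -/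
def StartsWith (X : Fin n → SignType) (s : SignType) : Prop :=
  ∃ k, k + 1 = alternationLength X ∧ ∃ j : Fin (k + 1) → Fin n, IsAlternating X j ∧ X (j 0) = s

theorem exists_startsWith (hX : X ≠ 0) : ∃ s, StartsWith X s := by
  obtain ⟨k, hk⟩ := Nat.exists_eq_succ_of_ne_zero (alternationLength_pos hX).ne'
  obtain ⟨j, hj⟩ : ∃ j : Fin (k + 1) → Fin n, IsAlternating X j := by
    rw [← Nat.succ_eq_add_one, ← hk]
    exact exists_isAlternating X
  exact ⟨X (j 0), k, hk.symm, j, hj, rfl⟩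

theorem StartsWith.ne_zero {s : SignType} (h : StartsWith X s) : s ≠ 0 := by
  obtain ⟨k, -, j, hj, rfl⟩ := h
  exact hj.2.1 0

/-- If two longest alternating subsequences began with different signs, the earlier first term could
be prepended to the other one. -/
theorem StartsWith.unique {s t : SignType} (hs : StartsWith X s) (ht : StartsWith X t) :
    s = t := by
  obtain ⟨k, hk, j, hj, rfl⟩ := hs
  obtain ⟨k', hk', j', hj', rfl⟩ := ht
  by_contra hne
  rcases lt_trichotomy (j 0) (j' 0) with h | h | h
  · have := (hj'.cons h (hj.2.1 0) hne).le_alternationLength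
    omega
  · exact hne (by rw [h])
  · have := (hj.cons h (hj'.2.1 0) (Ne.symm hne)).le_alternationLength
    omega

theorem StartsWith.neg {s : SignType} (h : StartsWith X s) : StartsWith (-X) (-s) := by
  obtain ⟨k, hk, j, hj, rfl⟩ := h
  exact ⟨k, by rw [alternationLength_neg, hk], j, hj.neg, rfl⟩

theorem StartsWith.mono {s : SignType} (h : StartsWith X s) (hXY : SignLE X Y)
    (heq : alternationLength X = alternationLength Y) : StartsWith Y s := by
  obtain ⟨k, hk, j, hj, rfl⟩ := h
  exact ⟨k, by rw [← heq, hk], j, hj.mono hXY, hXY _ (hj.2.1 0)⟩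

theorem startsWith_neg_one (hX : X ≠ 0) : StartsWith (-X) 1 ↔ ¬ StartsWith X 1 := by
  obtain ⟨s, hs⟩ := exists_startsWith hX
  have h0 := hs.ne_zero
  constructor
  · intro h h'
    exact absurd (h.unique h'.neg) (by decide)
  · intro h
    have : s = -1 := by
      rcases s.trichotomy with h1 | h1 | h1
      · exact h1
      · exact absurd h1 h0
      · exact absurd (h1 ▸ hs) h
    subst this
    simpa using hs.neg

open Classical in
/-- If the sign vectors with an alternating subsequence longer than `a` have an antisymmetric
labelling by `t` labels and their negatives without complementary comparable pairs, then
`n ≤ a + t`. -/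
theorem le_add_of_signed_labelling {a t : ℕ} (f : (Fin n → SignType) → ℕ)
    (pos : (Fin n → SignType) → Prop) (hlt : ∀ X, a < alternationLength X → f X < t)
    (hneg : ∀ X, a < alternationLength X → f (-X) = f X)
    (hpos : ∀ X, a < alternationLength X → (pos (-X) ↔ ¬ pos X))
    (hle : ∀ X Y, a < alternationLength X → a < alternationLength Y → SignLE X Y → f X = f Y →
      (pos X ↔ pos Y)) : n ≤ a + t := by
  -- Short alternations use the indices below `a` and long ones those from `a` on, so complementary
  -- labels can meet only within one of the two kinds.
  let lam : (Fin n → SignType) → ℕ ×ₗ Bool := fun X =>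
    if alternationLength X ≤ a then toLex (alternationLength X - 1, decide (StartsWith X 1))
    else toLex (a + f X, decide (pos X))
  have h1 (X) (h : alternationLength X ≤ a) :
      lam X = toLex (alternationLength X - 1, decide (StartsWith X 1)) := if_pos h
  have h2 (X) (h : ¬ alternationLength X ≤ a) : lam X = toLex (a + f X, decide (pos X)) := if_neg h
  have hlam : IsTuckerLabelling lam := by
    constructor
    · intro X hX
      by_cases h : alternationLength X ≤ a
      · rw [h1 X h, h1 (-X) (by rwa [alternationLength_neg]), alternationLength_neg]
        simp [startsWith_neg_one hX]
      · rw [h2 X h, h2 (-X) (by rwa [alternationLength_neg])]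
        simp [hneg X (not_le.1 h), hpos X (not_le.1 h)]
    · intro X Y hX hY hXY
      have hX0 := alternationLength_pos hX
      have hY0 := alternationLength_pos hY
      by_cases h : alternationLength X ≤ a <;> by_cases h' : alternationLength Y ≤ a
      · rw [h1 X h, h1 Y h']
        simp only [ofLex_toLex, decide_eq_decide]
        intro heq
        have heq : alternationLength X = alternationLength Y := by omega
        obtain ⟨s, hs⟩ := exists_startsWith hX
        refine ⟨fun hp => hp.mono hXY heq, fun hp => ?_⟩
        rwa [← (hs.mono hXY heq).unique hp]
      · rw [h1 X h, h2 Y h']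
        simp only [ofLex_toLex]
        omega
      · rw [h2 X h, h1 Y h']
        simp only [ofLex_toLex]
        omega
      · rw [h2 X h, h2 Y h']
        simp only [ofLex_toLex, decide_eq_decide]
        intro heq
        exact hle X Y (not_le.1 h) (not_le.1 h') hXY (by omega)
  refine hlam.le fun X hX => ?_
  have hX0 := alternationLength_pos hX
  by_cases h : alternationLength X ≤ a
  · rw [h1 X h]
    simp only [ofLex_toLex]
    omega
  · rw [h2 X h]
    simpa using hlt X (not_le.1 h)

end

/-! ### The altermatic lower bounds for the chromatic number -/

namespace Hypergraph

section

variable {α : Type*} {K : Hypergraph α} {n t : ℕ} (σ : Fin n ≃ K.vertexSet)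
  (c : K.kneserGraph.Coloring (Fin t))

theorem signClass_neg (X : Fin n → SignType) (s : SignType) :
    signClass σ (-X) s = signClass σ X (-s) := by
  ext v
  simp [signClass, neg_eq_iff_eq_neg]

theorem disjoint_signClass (X : Fin n → SignType) {s s' : SignType} (h : s ≠ s') :
    Disjoint (signClass σ X s) (signClass σ X s') := by
  rw [Set.disjoint_left]
  rintro _ ⟨j, hj, rfl⟩ ⟨j', hj', h'⟩
  have := σ.injective (Subtype.ext h')
  subst this
  exact h (hj.symm.trans hj')

theorem signClass_mono {X Y : Fin n → SignType} (hXY : SignLE X Y) {s : SignType} (hs : s ≠ 0) :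
    signClass σ X s ⊆ signClass σ Y s := by
  rintro _ ⟨j, hj, rfl⟩
  exact ⟨j, by rw [hXY j (hj ▸ hs), hj], rfl⟩

variable {σ}

/-- The largest colour, counted from one, of a hyperedge contained in `U`. -/
noncomputable def maxColor (U : Set α) : ℕ :=
  sSup {k | ∃ A : K.edgeSet, (A : Set α) ⊆ U ∧ (c A : ℕ) + 1 = k}

theorem bddAbove_maxColor (U : Set α) :
    BddAbove {k | ∃ A : K.edgeSet, (A : Set α) ⊆ U ∧ (c A : ℕ) + 1 = k} := by
  refine ⟨t, ?_⟩
  rintro _ ⟨A, -, rfl⟩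
  exact (c A).2

theorem le_maxColor {U : Set α} {A : K.edgeSet} (hA : (A : Set α) ⊆ U) :
    (c A : ℕ) + 1 ≤ maxColor c U :=
  le_csSup (bddAbove_maxColor c U) ⟨A, hA, rfl⟩

theorem exists_eq_maxColor {U : Set α} (h : 0 < maxColor c U) :
    ∃ A : K.edgeSet, (A : Set α) ⊆ U ∧ (c A : ℕ) + 1 = maxColor c U := by
  refine Nat.sSup_mem (Set.nonempty_iff_ne_empty.2 fun h0 => ?_) (bddAbove_maxColor c U)
  rw [maxColor, h0] at h
  simp at h

theorem maxColor_le (U : Set α) : maxColor c U ≤ t := by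
  rcases Nat.eq_zero_or_pos (maxColor c U) with h | h
  · omega
  · obtain ⟨A, -, hA⟩ := exists_eq_maxColor c h
    have := (c A).2
    omega

theorem maxColor_pos {U : Set α} (h : K.ContainsEdge U) : 0 < maxColor c U := by
  obtain ⟨A, hA, hAU⟩ := h
  have := le_maxColor c (A := ⟨A, hA⟩) hAU
  omega

theorem maxColor_mono {U V : Set α} (h : U ⊆ V) : maxColor c U ≤ maxColor c V := by
  rcases Nat.eq_zero_or_pos (maxColor c U) with h0 | h0
  · omega
  · obtain ⟨A, hAU, hA⟩ := exists_eq_maxColor c h0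
    rw [← hA]
    exact le_maxColor c (hAU.trans h)

/-- Hyperedges attaining a common value would be disjoint, hence adjacent (nonemptiness makes them
distinct), yet have the same colour. -/
theorem maxColor_ne (hK : ∅ ∉ K.edgeSet) {U V : Set α} (hUV : Disjoint U V)
    (h : 0 < maxColor c U) : maxColor c U ≠ maxColor c V := by
  intro heq
  obtain ⟨A, hAU, hA⟩ := exists_eq_maxColor c h
  obtain ⟨B, hBV, hB⟩ := exists_eq_maxColor c (heq ▸ h)
  have hd : Disjoint (A : Set α) (B : Set α) := hUV.mono hAU hBV
  refine c.valid (v := A) (w := B) ⟨fun hAB => ?_, hd⟩ (Fin.ext (by omega))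
  subst hAB
  have hA0 : (A : Set α) = ∅ := disjoint_self.1 hd
  exact hK (hA0 ▸ A.2)

theorem le_altOrd {X : Fin n → SignType} (hX : X ≠ 0)
    (h1 : ¬ K.ContainsEdge (signClass σ X 1)) (h2 : ¬ K.ContainsEdge (signClass σ X (-1))) :
    alternationLength X ≤ altOrd σ :=
  le_csSup ⟨n, by rintro _ ⟨X, -, rfl, -⟩; exact alternationLength_le X⟩ ⟨X, hX, rfl, h1, h2⟩

theorem le_saltOrd {X : Fin n → SignType} (hX : X ≠ 0)
    (h : ¬ (K.ContainsEdge (signClass σ X 1) ∧ K.ContainsEdge (signClass σ X (-1)))) :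
    alternationLength X ≤ saltOrd σ :=
  le_csSup ⟨n, by rintro _ ⟨X, -, rfl, -⟩; exact alternationLength_le X⟩ ⟨X, hX, rfl, h⟩

theorem ne_zero_of_lt_alternationLength {a : ℕ} {X : Fin n → SignType}
    (h : a < alternationLength X) : X ≠ 0 := by
  rintro rfl
  obtain ⟨j, hj⟩ := exists_isAlternating (0 : Fin n → SignType)
  exact hj.2.1 ⟨0, by omega⟩ rfl

include c in
theorem card_le_altOrd_add (hK : ∅ ∉ K.edgeSet) : n ≤ altOrd σ + t := by
  have hpos (X) (h : altOrd σ < alternationLength X) :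
      0 < maxColor c (signClass σ X 1) ∨ 0 < maxColor c (signClass σ X (-1)) := by
    by_contra! h0
    refine absurd (le_altOrd (ne_zero_of_lt_alternationLength h) (fun h1 => ?_) fun h1 => ?_)
      (not_le.2 h)
    · have := maxColor_pos c h1
      omega
    · have := maxColor_pos c h1
      omega
  have hne (X) (h : altOrd σ < alternationLength X) :
      maxColor c (signClass σ X 1) ≠ maxColor c (signClass σ X (-1)) := by
    rcases hpos X h with h1 | h1
    · exact maxColor_ne c hK (disjoint_signClass σ X (by decide)) h1
    · exact (maxColor_ne c hK (disjoint_signClass σ X (by decide)) h1).symm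
  refine le_add_of_signed_labelling
    -- The sign records which class attains the maximum. When the vector grows and the maximum
    -- stays, that class still attains it. Colours count from one, hence the shift.
    (fun X => max (maxColor c (signClass σ X 1)) (maxColor c (signClass σ X (-1))) - 1)
    (fun X => maxColor c (signClass σ X (-1)) < maxColor c (signClass σ X 1)) ?_ ?_ ?_ ?_
  · intro X hX
    have := hpos X hX
    have := maxColor_le c (signClass σ X 1)
    have := maxColor_le c (signClass σ X (-1))
    omega
  · intro X _
    simp only [signClass_neg, neg_neg, max_comm]
  · intro X hX
    have := hne X hX
    simp only [signClass_neg, neg_neg]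
    omega
  · intro X Y hX hY hXY heq
    have hX1 := hpos X hX
    have hY1 := hpos Y hY
    have h1 := maxColor_mono c (signClass_mono σ hXY (s := 1) (by decide))
    have h2 := maxColor_mono c (signClass_mono σ hXY (s := -1) (by decide))
    have := hne X hX
    have := hne Y hY
    omega

include c in
theorem card_le_saltOrd_add (hK : ∅ ∉ K.edgeSet) : n ≤ saltOrd σ + (t - 1) := by
  have hpos (X) (h : saltOrd σ < alternationLength X) :
      0 < maxColor c (signClass σ X 1) ∧ 0 < maxColor c (signClass σ X (-1)) := by
    by_contra h0
    refine absurd (le_saltOrd (ne_zero_of_lt_alternationLength h) fun h1 => h0 ?_) (not_le.2 h)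
    exact ⟨maxColor_pos c h1.1, maxColor_pos c h1.2⟩
  have hne (X) (h : saltOrd σ < alternationLength X) :
      maxColor c (signClass σ X 1) ≠ maxColor c (signClass σ X (-1)) :=
    maxColor_ne c hK (disjoint_signClass σ X (by decide)) (hpos X h).1
  refine le_add_of_signed_labelling
    -- Here both classes contain hyperedges, and the smaller of two distinct values in `1, …, t` is
    -- at most `t - 1`: this saves one label compared with the maximum.
    (fun X => min (maxColor c (signClass σ X 1)) (maxColor c (signClass σ X (-1))) - 1)
    (fun X => maxColor c (signClass σ X (-1)) < maxColor c (signClass σ X 1)) ?_ ?_ ?_ ?_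
  · intro X hX
    have := hpos X hX
    have := hne X hX
    have := maxColor_le c (signClass σ X 1)
    have := maxColor_le c (signClass σ X (-1))
    omega
  · intro X _
    simp only [signClass_neg, neg_neg, min_comm]
  · intro X hX
    have := hne X hX
    simp only [signClass_neg, neg_neg]
    omega
  · intro X Y hX hY hXY heq
    have hX1 := hpos X hX
    have hY1 := hpos Y hY
    have h1 := maxColor_mono c (signClass_mono σ hXY (s := 1) (by decide))
    have h2 := maxColor_mono c (signClass_mono σ hXY (s := -1) (by decide))
    have := hne X hX
    have := hne Y hY
    omega

end

section

variable {α : Type*} {K : Hypergraph α}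

theorem nonempty_orderings (hV : K.vertexSet.Finite) :
    Nonempty (Fin K.vertexSet.ncard ≃ K.vertexSet) := by
  have := hV.to_subtype
  exact ⟨(Finite.equivFinOfCardEq (Nat.card_coe_set_eq _)).symm⟩

theorem exists_altOrd_eq (hV : K.vertexSet.Finite) :
    ∃ σ : Fin K.vertexSet.ncard ≃ K.vertexSet, altOrd σ = K.alt := by
  have := nonempty_orderings hV
  exact Nat.sInf_mem (Set.range_nonempty _)

theorem exists_saltOrd_eq (hV : K.vertexSet.Finite) :
    ∃ σ : Fin K.vertexSet.ncard ≃ K.vertexSet, saltOrd σ = K.salt := by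
  have := nonempty_orderings hV
  exact Nat.sInf_mem (Set.range_nonempty _)

theorem ncard_vertexSet_eq {n : ℕ} (σ : Fin n ≃ K.vertexSet) : K.vertexSet.ncard = n := by
  rw [← Nat.card_coe_set_eq, ← Nat.card_congr σ, Nat.card_fin]

theorem alt_le_altOrd {n : ℕ} (σ : Fin n ≃ K.vertexSet) : K.alt ≤ altOrd σ := by
  obtain rfl := ncard_vertexSet_eq σ
  exact Nat.sInf_le ⟨σ, rfl⟩

theorem salt_le_saltOrd {n : ℕ} (σ : Fin n ≃ K.vertexSet) : K.salt ≤ saltOrd σ := by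
  obtain rfl := ncard_vertexSet_eq σ
  exact Nat.sInf_le ⟨σ, rfl⟩

end

end Hypergraph

namespace SimpleGraph

variable {W : Type*} (Γ : SimpleGraph W)

theorem altermaticNumber_le_chromaticNumber : Γ.altermaticNumber ≤ Γ.chromaticNumber := by
  refine iSup₂_le fun K hK => le_chromaticNumber_iff_coloring.2 fun t c => ?_
  obtain ⟨hV, hE, ⟨φ⟩⟩ := hK
  obtain ⟨σ, hσ⟩ := Hypergraph.exists_altOrd_eq hV
  have := Hypergraph.card_le_altOrd_add (σ := σ) (c.comp φ.toHom) hE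
  exact_mod_cast (by omega : K.vertexSet.ncard - K.alt ≤ t)

theorem strongAltermaticNumber_le_chromaticNumber [Nonempty W] :
    Γ.strongAltermaticNumber ≤ Γ.chromaticNumber := by
  refine iSup₂_le fun K hK => le_chromaticNumber_iff_coloring.2 fun t c => ?_
  obtain ⟨hV, hE, ⟨φ⟩⟩ := hK
  obtain ⟨σ, hσ⟩ := Hypergraph.exists_saltOrd_eq hV
  have := Hypergraph.card_le_saltOrd_add (σ := σ) (c.comp φ.toHom) hE
  -- Needed because `t - 1` truncates: the graph without vertices has chromatic number `0` but
  -- strong altermatic number `1`.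
  have ht : 0 < t := (c (Classical.arbitrary W)).pos
  exact_mod_cast (by omega : K.vertexSet.ncard + 1 - K.salt ≤ t)

end SimpleGraph

/-! ### Kneser representations on the natural numbers -/

namespace Hypergraph

section

variable {α : Type*} {K : Hypergraph α} {n : ℕ} (σ : Fin n ≃ K.vertexSet)

/-- The positions of the members of `A` in the ordering `σ`. -/
def positions (A : Set α) : Set ℕ := Fin.val '' ((fun j => (σ j : α)) ⁻¹' A)

/-- The copy of `K` on the vertex set `{0, …, n - 1}` given by the ordering `σ`. -/
def toNat : Hypergraph ℕ where
  vertexSet := Set.range (Fin.val : Fin n → ℕ)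
  edgeSet := positions σ '' K.edgeSet
  subset_vertexSet_of_mem_edgeSet' := by
    rintro _ ⟨A, -, rfl⟩
    exact Set.image_subset_range _ _

theorem positions_subset_positions {A B : Set α} (hA : A ∈ K.edgeSet)
    (h : positions σ A ⊆ positions σ B) : A ⊆ B := by
  intro v hv
  obtain ⟨j, hj⟩ := σ.surjective ⟨v, K.subset_vertexSet_of_mem_edgeSet' hA hv⟩
  have h' := (Set.image_subset_image_iff Fin.val_injective).1 h
  have := h' (show j ∈ (fun j => (σ j : α)) ⁻¹' A by simpa [hj] using hv)
  simpa [hj] using this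

theorem disjoint_positions {A B : Set α} (hA : A ∈ K.edgeSet) :
    Disjoint (positions σ A) (positions σ B) ↔ Disjoint A B := by
  rw [positions, positions, Set.disjoint_image_iff Fin.val_injective]
  refine ⟨fun h => Set.disjoint_left.2 fun v hvA hvB => ?_, fun h => h.preimage _⟩
  obtain ⟨j, hj⟩ := σ.surjective ⟨v, K.subset_vertexSet_of_mem_edgeSet' hA hvA⟩
  exact Set.disjoint_left.1 h (show j ∈ (fun j => (σ j : α)) ⁻¹' A by simpa [hj] using hvA)
    (by simpa [hj] using hvB)

/-- The Kneser graph of a hypergraph is isomorphic to that of its copy on the natural numbers. -/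
noncomputable def kneserGraphToNatIso : (toNat σ).kneserGraph ≃g K.kneserGraph := by
  refine RelIso.symm ⟨Equiv.ofBijective
    (fun A => ⟨positions σ A, A, A.2, rfl⟩ : K.edgeSet → (toNat σ).edgeSet) ⟨?_, ?_⟩, ?_⟩
  · intro A B h
    have h : positions σ A = positions σ B := congrArg Subtype.val h
    exact Subtype.ext ((positions_subset_positions σ A.2 h.subset).antisymm
      (positions_subset_positions σ B.2 h.symm.subset))
  · rintro ⟨_, A, hA, rfl⟩
    exact ⟨⟨A, hA⟩, rfl⟩
  · intro A B
    have heq : positions σ (A : Set α) = positions σ B ↔ A = B :=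
      ⟨fun h => Subtype.ext ((positions_subset_positions σ A.2 h.subset).antisymm
        (positions_subset_positions σ B.2 h.symm.subset)), fun h => by rw [h]⟩
    exact and_congr (not_congr (Subtype.ext_iff.trans heq)) (disjoint_positions σ A.2)

/-- The ordering of the copy on the natural numbers. -/
noncomputable def toNatOrdering : Fin n ≃ (toNat σ).vertexSet :=
  Equiv.ofInjective _ Fin.val_injective

theorem containsEdge_toNat (X : Fin n → SignType) (s : SignType) :
    (toNat σ).ContainsEdge (signClass (toNatOrdering σ) X s) ↔
      K.ContainsEdge (signClass σ X s) := by
  have h1 : signClass (toNatOrdering σ) X s = Fin.val '' {j | X j = s} := rfl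
  have h2 (A) (hA : A ∈ K.edgeSet) :
      positions σ A ⊆ Fin.val '' {j | X j = s} ↔ A ⊆ signClass σ X s := by
    rw [positions, Set.image_subset_image_iff Fin.val_injective]
    constructor
    · intro h v hv
      obtain ⟨j, hj⟩ := σ.surjective ⟨v, K.subset_vertexSet_of_mem_edgeSet' hA hv⟩
      exact ⟨j, @h j (by simpa [hj] using hv), by rw [hj]⟩
    · intro h j hj
      obtain ⟨j', hj', he⟩ := h hj
      rw [← σ.injective (Subtype.ext he)]
      exact hj'
  constructor
  · rintro ⟨_, ⟨A, hA, rfl⟩, hAs⟩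
    exact ⟨A, hA, (h2 A hA).1 (h1 ▸ hAs)⟩
  · rintro ⟨A, hA, hAs⟩
    exact ⟨_, ⟨A, hA, rfl⟩, h1 ▸ (h2 A hA).2 hAs⟩

theorem altOrd_toNatOrdering : altOrd (toNatOrdering σ) = altOrd σ := by
  simp only [altOrd, containsEdge_toNat]

theorem saltOrd_toNatOrdering : saltOrd (toNatOrdering σ) = saltOrd σ := by
  simp only [saltOrd, containsEdge_toNat]

theorem isKneserRepresentation_toNat (hK : ∅ ∉ K.edgeSet) :
    (toNat σ).IsKneserRepresentation K.kneserGraph := by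
  refine ⟨Set.finite_range _, ?_, ⟨kneserGraphToNatIso σ⟩⟩
  rintro ⟨A, hA, h⟩
  have : A ⊆ ∅ := positions_subset_positions σ hA (by rw [h]; exact Set.empty_subset _)
  exact hK (Set.subset_empty_iff.1 this ▸ hA)

/-- The copy on the natural numbers makes a hypergraph over any vertex type admissible in the
supremum, and one good ordering suffices. -/
theorem card_sub_altOrd_le_altermaticNumber (hK : ∅ ∉ K.edgeSet) :
    ((n - altOrd σ : ℕ) : ℕ∞) ≤ K.kneserGraph.altermaticNumber := by
  refine le_trans ?_ (le_iSup₂_of_le (toNat σ) (isKneserRepresentation_toNat σ hK) le_rfl)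
  rw [ncard_vertexSet_eq (toNatOrdering σ), ← altOrd_toNatOrdering σ]
  exact_mod_cast Nat.sub_le_sub_left (alt_le_altOrd _) _

theorem card_sub_saltOrd_le_strongAltermaticNumber (hK : ∅ ∉ K.edgeSet) :
    ((n + 1 - saltOrd σ : ℕ) : ℕ∞) ≤ K.kneserGraph.strongAltermaticNumber := by
  refine le_trans ?_ (le_iSup₂_of_le (toNat σ) (isKneserRepresentation_toNat σ hK) le_rfl)
  rw [ncard_vertexSet_eq (toNatOrdering σ), ← saltOrd_toNatOrdering σ]
  exact_mod_cast Nat.sub_le_sub_left (salt_le_saltOrd _) _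

end

end Hypergraph

/-! ### Counting in alternating sequences arranged in blocks -/

section

variable {m : ℕ}

/-- The successor map injects the `P`-positions of the interval `I`, except the last one, into its
`Q`-positions. -/
theorem card_filter_le_of_consecutive (P Q : Fin m → Prop) [DecidablePred P] [DecidablePred Q]
    (I : Finset (Fin m)) (hPQ : ∀ i i' : Fin m, (i : ℕ) + 1 = (i' : ℕ) → P i → Q i')
    (hI : ∀ i ∈ I, ∀ l ∈ I, ∀ k, i ≤ k → k ≤ l → k ∈ I) :
    (I.filter P).card ≤ (I.filter Q).card + 1 := by
  rcases (I.filter P).eq_empty_or_nonempty with h | h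
  · simp [h]
  set M := (I.filter P).max' h with hM
  have hMm : M ∈ I.filter P := Finset.max'_mem _ h
  rw [← Finset.card_erase_add_one hMm]
  refine Nat.succ_le_succ (Finset.card_le_card_of_injOn
    (fun i => if hi : (i : ℕ) + 1 < m then ⟨i + 1, hi⟩ else i) ?_ ?_)
  · intro i hi
    have hi' : i ≠ M ∧ i ∈ I ∧ P i := by
      simpa [and_comm] using hi
    have hlt : i < M := lt_of_le_of_ne
      (Finset.le_max' _ _ (Finset.mem_filter.2 hi'.2)) hi'.1
    have hlt' : (i : ℕ) + 1 ≤ M := hlt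
    have hlt2 : (i : ℕ) + 1 < m := hlt'.trans_lt M.2
    simp only [hlt2, dite_true, Finset.coe_filter, Set.mem_ofPred_eq]
    refine ⟨hI i hi'.2.1 M (Finset.mem_filter.1 hMm).1 _ ?_ hlt', hPQ i _ rfl hi'.2.2⟩
    exact Fin.le_def.2 (Nat.le_succ _)
  · intro i hi i' hi' h
    have hlt (k : Fin m) (hk : k ∈ (I.filter P).erase M) : (k : ℕ) + 1 < m := by
      rw [Finset.mem_erase] at hk
      have : k < M := lt_of_le_of_ne (Finset.le_max' _ _ hk.2) hk.1
      have : (k : ℕ) < M := this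
      have := M.2
      omega
    simpa [hlt i hi, hlt i' hi', Fin.ext_iff] using h

variable {ι : Type*} [Fintype ι] [DecidableEq ι] {x : Fin m → SignType} {p : Fin m → ι} {r a : ℕ}

/-- An alternating sequence arranged in blocks of length at most `r`, the positive terms and the
negative terms meeting at most `a` blocks each, has length at most `r * a`. -/
theorem length_le_of_blocks (h0 : ∀ i, x i ≠ 0)
    (hx : ∀ i i' : Fin m, (i : ℕ) + 1 = (i' : ℕ) → x i ≠ x i')
    (hp : ∀ i l, p i = p l → ∀ k, i ≤ k → k ≤ l → p k = p i)
    (hr : 2 ≤ r) (hpr : ∀ e, (Finset.univ.filter fun i => p i = e).card ≤ r) {A B : Finset ι}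
    (hA : ∀ i, x i = 1 → p i ∈ A) (hB : ∀ i, x i = -1 → p i ∈ B) (hAa : A.card ≤ a)
    (hBa : B.card ≤ a) : m ≤ r * a := by
  have hsign (i : Fin m) (hi : x i ≠ 1) : x i = -1 := by
    rcases (x i).trichotomy with h | h | h
    · exact h
    · exact absurd h (h0 i)
    · exact absurd h hi
  -- Inside a block the two signs differ in number by at most one, so a block meeting one sign has
  -- at most one term; one meeting both has at most `r = 1 + 1 + (r - 2)`.
  have key (e : ι) : (Finset.univ.filter fun i => p i = e).card ≤
      (if e ∈ A then 1 else 0) + (if e ∈ B then 1 else 0) + if e ∈ A ∩ B then r - 2 else 0 := by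
    set I := Finset.univ.filter fun i => p i = e with hI
    have hconv : ∀ i ∈ I, ∀ l ∈ I, ∀ k, i ≤ k → k ≤ l → k ∈ I := by
      intro i hi l hl k hik hkl
      simp only [hI, Finset.mem_filter, Finset.mem_univ, true_and] at hi hl ⊢
      rw [hp i l (hi.trans hl.symm) k hik hkl, hi]
    have h1 := card_filter_le_of_consecutive (fun i => x i = 1) (fun i => ¬ x i = 1) I
      (fun i i' hi h h' => hx i i' hi (h.trans h'.symm)) hconv
    have h2 := card_filter_le_of_consecutive (fun i => ¬ x i = 1) (fun i => x i = 1) I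
      (fun i i' hi h => by
        by_contra h'
        exact hx i i' hi ((hsign i h).trans (hsign i' h').symm)) hconv
    have h3 := Finset.card_filter_add_card_filter_not (s := I) (fun i => x i = 1)
    have h4 : e ∉ A → (I.filter fun i => x i = 1).card = 0 := by
      intro he
      rw [Finset.card_eq_zero, Finset.filter_eq_empty_iff]
      intro i hi h
      exact he ((Finset.mem_filter.1 hi).2 ▸ hA i h)
    have h5 : e ∉ B → (I.filter fun i => ¬ x i = 1).card = 0 := by
      intro he
      rw [Finset.card_eq_zero, Finset.filter_eq_empty_iff]
      intro i hi h
      exact he ((Finset.mem_filter.1 hi).2 ▸ hB i (hsign i h))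
    have h6 := hpr e
    rw [← hI] at h6
    by_cases heA : e ∈ A <;> by_cases heB : e ∈ B <;>
      simp only [heA, heB, Finset.mem_inter, not_true_eq_false, not_false_eq_true, if_true,
        if_false, and_true, and_false, true_implies, IsEmpty.forall_iff] at h4 h5 ⊢ <;> omega
  have hm : m = ∑ e, (Finset.univ.filter fun i => p i = e).card := by
    simpa using Finset.card_eq_sum_card_fiberwise (s := (Finset.univ : Finset (Fin m)))
      (t := Finset.univ) (f := p) (by simp)
  have hsum := Finset.sum_le_sum fun e (_ : e ∈ Finset.univ) => key e
  rw [← hm] at hsum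
  simp only [Finset.sum_add_distrib, Finset.sum_ite_mem, Finset.univ_inter, Finset.sum_const,
    smul_eq_mul, mul_one] at hsum
  have hAB : (A ∩ B).card ≤ a := (Finset.card_le_card Finset.inter_subset_left).trans hAa
  obtain ⟨q, rfl⟩ := Nat.exists_eq_add_of_le hr
  have := Nat.mul_le_mul_right q hAB
  simp only [Nat.add_sub_cancel_left] at hsum
  nlinarith

/-- An alternating sequence arranged in blocks of length at most `r`, where `r` is even and the
terms of sign `s` meet at most `a` blocks, has length at most `r * a + 1`. -/
theorem length_le_of_blocks_of_even (s : SignType) (hs : s ≠ 0) (h0 : ∀ i, x i ≠ 0)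
    (hx : ∀ i i' : Fin m, (i : ℕ) + 1 = (i' : ℕ) → x i ≠ x i')
    (hp : ∀ i l, p i = p l → ∀ k, i ≤ k → k ≤ l → p k = p i)
    (hr : Even r) (hpr : ∀ e, (Finset.univ.filter fun i => p i = e).card ≤ r) {A : Finset ι}
    (hA : ∀ i, x i = s → p i ∈ A) (hAa : A.card ≤ a) : m ≤ r * a + 1 := by
  have hsign (i : Fin m) (hi : x i ≠ s) : x i = -s := by
    have := h0 i
    have key : ∀ s t : SignType, s ≠ 0 → t ≠ 0 → t ≠ s → t = -s := by decide
    exact key s (x i) hs this hi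
  -- Alternation only gives the bound `r + 1`; evenness of `r` improves it to `r`.
  have key (e : ι) : 2 * ((Finset.univ.filter fun i => x i = s).filter fun i => p i = e).card ≤
      if e ∈ A then r else 0 := by
    rw [Finset.filter_comm]
    set I := Finset.univ.filter fun i => p i = e with hI
    have hconv : ∀ i ∈ I, ∀ l ∈ I, ∀ k, i ≤ k → k ≤ l → k ∈ I := by
      intro i hi l hl k hik hkl
      simp only [hI, Finset.mem_filter, Finset.mem_univ, true_and] at hi hl ⊢
      rw [hp i l (hi.trans hl.symm) k hik hkl, hi]
    have h1 := card_filter_le_of_consecutive (fun i => x i = s) (fun i => ¬ x i = s) I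
      (fun i i' hi h h' => hx i i' hi (h.trans h'.symm)) hconv
    have h3 := Finset.card_filter_add_card_filter_not (s := I) (fun i => x i = s)
    have h6 := hpr e
    rw [← hI] at h6
    obtain ⟨q, hq⟩ := hr
    by_cases heA : e ∈ A
    · rw [if_pos heA]
      omega
    · have h4 : (I.filter fun i => x i = s).card = 0 := by
        rw [Finset.card_eq_zero, Finset.filter_eq_empty_iff]
        intro i hi h
        exact heA ((Finset.mem_filter.1 hi).2 ▸ hA i h)
      omega
  have hm := Finset.card_eq_sum_card_fiberwise (s := (Finset.univ.filter fun i => x i = s))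
      (t := Finset.univ) (f := p) (by simp)
  have hsum := Finset.sum_le_sum fun e (_ : e ∈ Finset.univ) => key e
  rw [← Finset.mul_sum, ← hm] at hsum
  simp only [Finset.sum_ite_mem, Finset.univ_inter, Finset.sum_const, smul_eq_mul] at hsum
  have h2 := card_filter_le_of_consecutive (fun i => ¬ x i = s) (fun i => x i = s)
    Finset.univ (fun i i' hi h => by
      by_contra h'
      exact hx i i' hi ((hsign i h).trans (hsign i' h').symm)) (by simp)
  have h3 := Finset.card_filter_add_card_filter_not (s := Finset.univ) (fun i => x i = s)
  simp only [Finset.card_univ, Fintype.card_fin] at h2 h3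
  have := Nat.mul_le_mul_right r hAa
  nlinarith

end

/-! ### Copies in multiplied graphs -/

namespace Graph

section

variable {α α' β β' γ : Type*}

/-- The graph obtained from `K` by renaming its edges. -/
def mapEdges (K : Graph α β) (φ : K.edgeSet → γ) (hφ : Function.Injective φ) : Graph α γ where
  vertexSet := K.vertexSet
  IsLink d x y := ∃ e : K.edgeSet, φ e = d ∧ K.IsLink e x y
  isLink_symm := fun _ _ => ⟨fun _ _ ⟨e, he, h⟩ => ⟨e, he, h.symm⟩⟩
  eq_or_eq_of_isLink_of_isLink := by
    rintro d x y v w ⟨e, rfl, h⟩ ⟨e', he', h'⟩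
    obtain rfl := hφ he'
    exact h.left_eq_or_eq h'
  left_mem_of_isLink := fun _ _ _ ⟨_, _, h⟩ => h.left_mem

variable {K : Graph α β} {φ : K.edgeSet → γ} {hφ : Function.Injective φ}

theorem edgeSet_mapEdges : (K.mapEdges φ hφ).edgeSet = Set.range φ := by
  ext d
  constructor
  · rintro ⟨_, _, e, rfl, -⟩
    exact ⟨e, rfl⟩
  · rintro ⟨e, rfl⟩
    obtain ⟨x, y, h⟩ := exists_isLink_of_mem_edgeSet e.2
    exact ⟨x, y, e, rfl, h⟩

theorem IsIsomorphicTo.mapEdges {F : Graph α' β'} (h : K.IsIsomorphicTo F) :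
    (K.mapEdges φ hφ).IsIsomorphicTo F := by
  obtain ⟨f, ψ, hψ⟩ := h
  let τ : (K.mapEdges φ hφ).edgeSet ≃ K.edgeSet :=
    (Equiv.setCongr edgeSet_mapEdges).trans (Equiv.ofInjective φ hφ).symm
  have hτ (d) : φ (τ d) = d := by
    have := (Equiv.ofInjective φ hφ).apply_symm_apply (Equiv.setCongr edgeSet_mapEdges d)
    exact congrArg Subtype.val this
  refine ⟨f, τ.trans ψ, fun d x y => ?_⟩
  rw [Equiv.trans_apply]
  refine Iff.trans ?_ (hψ (τ d) x y)
  constructor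
  · rintro ⟨e, he, h⟩
    rwa [← hφ (he.trans (hτ d).symm)]
  · exact fun h => ⟨_, hτ d, h⟩

theorem IsIsomorphicTo.refl (K : Graph α β) : K.IsIsomorphicTo K :=
  ⟨Equiv.refl _, Equiv.refl _, fun _ _ _ => Iff.rfl⟩

theorem finite_edgeSet_of_finite_vertexSet {H : Graph α β} (hH : H.Simple)
    (hfin : H.vertexSet.Finite) : H.edgeSet.Finite := by
  choose u v huv using fun e : H.edgeSet => exists_isLink_of_mem_edgeSet e.2
  have := hfin.to_subtype
  have hinj : Function.Injective
      (fun e => (⟨u e, (huv e).left_mem⟩, ⟨v e, (huv e).right_mem⟩) :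
        H.edgeSet → H.vertexSet × H.vertexSet) := by
    intro e e' h
    simp only [Prod.mk.injEq, Subtype.mk.injEq] at h
    exact Subtype.ext (hH.eq_of_isLink (huv e) (by rw [h.1, h.2]; exact huv e'))
  have := Finite.of_injective _ hinj
  exact Set.toFinite _

variable {G : Graph α β} {𝓕 : Set (Graph α' β')}

theorem bddAbove_turanNumber (hG : G.edgeSet.Finite) :
    BddAbove {m : ℕ | ∃ K : Graph α β, K ≤s G ∧ K.IsFreeOf 𝓕 ∧ K.edgeSet.ncard = m} := by
  refine ⟨G.edgeSet.ncard, ?_⟩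
  rintro _ ⟨K, hK, -, rfl⟩
  exact Set.ncard_le_ncard (IsSubgraph.edgeSet_mono hK.le) hG

theorem le_turanNumber (hG : G.edgeSet.Finite) {K : Graph α β} (hK : K ≤s G)
    (hfree : K.IsFreeOf 𝓕) : K.edgeSet.ncard ≤ G.turanNumber 𝓕 :=
  le_csSup (bddAbove_turanNumber hG) ⟨K, hK, hfree, rfl⟩

theorem exists_ncard_eq_turanNumber (hG : G.edgeSet.Finite)
    (h : ∃ K : Graph α β, K ≤s G ∧ K.IsFreeOf 𝓕) :
    ∃ K : Graph α β, K ≤s G ∧ K.IsFreeOf 𝓕 ∧ K.edgeSet.ncard = G.turanNumber 𝓕 := by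
  obtain ⟨K, hK, hfree⟩ := h
  exact Nat.sSup_mem
    (s := {m : ℕ | ∃ K : Graph α β, K ≤s G ∧ K.IsFreeOf 𝓕 ∧ K.edgeSet.ncard = m})
    ⟨_, K, hK, hfree, rfl⟩ (bddAbove_turanNumber hG)

theorem restrict_isSpanningSubgraph (G : Graph α β) (Z : Set β) : G.restrict Z ≤s G where
  le := restrict_le
  vertexSet_eq := rfl

theorem empty_notMem_copyHypergraph : ∅ ∉ (G.copyHypergraph 𝓕).edgeSet :=
  fun h => Set.not_nonempty_empty h.1

/-- Colouring each copy by one of its edges outside a largest `𝓕`-free spanning subgraph. -/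
theorem chromaticNumber_kneserGraphOf_le (hG : G.edgeSet.Finite)
    (h : ∃ K : Graph α β, K ≤s G ∧ K.IsFreeOf 𝓕) :
    (G.kneserGraphOf 𝓕).chromaticNumber ≤ ((G.edgeSet.ncard - G.turanNumber 𝓕 : ℕ) : ℕ∞) := by
  obtain ⟨K, hK, hfree, hcard⟩ := exists_ncard_eq_turanNumber hG h
  have hA (A : (G.copyHypergraph 𝓕).edgeSet) : ∃ e, e ∈ (A : Set β) ∧ e ∉ K.edgeSet := by
    obtain ⟨_, -, L, hL, ⟨F, hF, hLF⟩, rfl⟩ := A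
    -- A copy with all its edges in `K` is a subgraph of `K`, since `K` is spanning.
    by_contra! hsub
    refine hfree L (Compatible.le_iff (Compatible.of_le_le hL hK.le) |>.2 ⟨?_, hsub⟩) F hF hLF
    rw [hK.vertexSet_eq]
    exact IsSubgraph.vertexSet_mono hL
  choose f hf hf' using hA
  have hmem (A : (G.copyHypergraph 𝓕).edgeSet) : f A ∈ G.edgeSet \ K.edgeSet :=
    ⟨(G.copyHypergraph 𝓕).subset_vertexSet_of_mem_edgeSet' A.2 (hf A), hf' A⟩
  have := (hG.subset (Set.sdiff_subset (t := K.edgeSet))).fintype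
  let c : (G.kneserGraphOf 𝓕).Coloring ↥(G.edgeSet \ K.edgeSet) :=
    SimpleGraph.Coloring.mk (fun A => ⟨f A, hmem A⟩) fun {A B} hAB heq => by
      have heq : f A = f B := congrArg Subtype.val heq
      exact Set.disjoint_left.1 hAB.2 (hf A) (heq ▸ hf B)
  refine c.colorable.chromaticNumber_le.trans ?_
  rw [← hcard, ← Set.ncard_sdiff (IsSubgraph.edgeSet_mono hK.le)
    (hG.subset (IsSubgraph.edgeSet_mono hK.le)), ← Nat.card_coe_set_eq, Nat.card_eq_fintype_card]

end

/-! ### Projecting the multiplied graph to the simple graph -/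

section

variable {α β γ : Type*} {H : Graph α β} {G : Graph α γ} {π : G.edgeSet → H.edgeSet}
  {𝓕 : Set (Graph α β)} {S : Set β} {r : ℕ}

theorem IsMultiplied.exists_projection (hG : G.IsMultiplied H S r) :
    ∃ π : G.edgeSet → H.edgeSet, ∀ (f : G.edgeSet) x y, G.IsLink f x y ↔ H.IsLink (π f) x y := by
  choose u v huv using fun f : G.edgeSet => exists_isLink_of_mem_edgeSet f.2
  choose e he using fun f : G.edgeSet => hG.adj_of_isLink _ _ _ (huv f)
  exact ⟨fun f => ⟨e f, (he f).edge_mem⟩, fun f x y => by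
    rw [(huv f).isLink_iff, (he f).isLink_iff]⟩

theorem encard_fiber_projection (hH : H.Simple)
    (hπ : ∀ (f : G.edgeSet) x y, G.IsLink f x y ↔ H.IsLink (π f) x y) (e : H.edgeSet) {x y : α}
    (he : H.IsLink e x y) : {f | π f = e}.encard = {f | G.IsLink f x y}.encard := by
  rw [← Subtype.val_injective.encard_image]
  congr 1
  ext f
  constructor
  · rintro ⟨f, hf, rfl⟩
    exact (hπ f x y).2 (hf ▸ he)
  · intro hf
    exact ⟨⟨f, hf.edge_mem⟩, Subtype.ext (hH.eq_of_isLink ((hπ ⟨f, hf.edge_mem⟩ x y).1 hf) he), rfl⟩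

theorem IsMultiplied.encard_fiber_eq (hG : G.IsMultiplied H S r) (hH : H.Simple)
    (hπ : ∀ (f : G.edgeSet) x y, G.IsLink f x y ↔ H.IsLink (π f) x y) {e : H.edgeSet} (he : (e : β) ∈ S) :
    {f | π f = e}.encard = r := by
  obtain ⟨x, y, hxy⟩ := exists_isLink_of_mem_edgeSet e.2
  rw [encard_fiber_projection hH hπ e hxy, hG.encard_of_mem e x y hxy he]

theorem IsMultiplied.encard_fiber_le (hG : G.IsMultiplied H S r) (hr : 1 ≤ r) (hH : H.Simple)
    (hπ : ∀ (f : G.edgeSet) x y, G.IsLink f x y ↔ H.IsLink (π f) x y) (e : H.edgeSet) :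
    1 ≤ {f | π f = e}.encard ∧ {f | π f = e}.encard ≤ r := by
  by_cases he : (e : β) ∈ S
  · rw [hG.encard_fiber_eq hH hπ he]
    exact ⟨by exact_mod_cast hr, le_rfl⟩
  · obtain ⟨x, y, hxy⟩ := exists_isLink_of_mem_edgeSet e.2
    rw [encard_fiber_projection hH hπ e hxy, hG.encard_of_notMem e x y hxy he]
    exact ⟨le_rfl, by exact_mod_cast hr⟩

theorem IsMultiplied.finite_edgeSet (hG : G.IsMultiplied H S r) (hr : 1 ≤ r) (hH : H.Simple)
    (hfin : H.vertexSet.Finite) (hπ : ∀ (f : G.edgeSet) x y, G.IsLink f x y ↔ H.IsLink (π f) x y) :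
    G.edgeSet.Finite := by
  have := (finite_edgeSet_of_finite_vertexSet hH hfin).to_subtype
  have h : (π ⁻¹' Set.univ).Finite := Set.finite_univ.preimage' fun e _ => by
    refine Set.finite_of_encard_le_coe (k := r) ?_
    exact (hG.encard_fiber_le hr hH hπ e).2
  rw [Set.preimage_univ, Set.finite_univ_iff] at h
  exact Set.toFinite _

/-- A copy in the projection of a set of edges can be lifted to that set. -/
theorem containsEdge_of_le_restrict_image (hV : G.vertexSet = H.vertexSet)
    (hπ : ∀ (f : G.edgeSet) x y, G.IsLink f x y ↔ H.IsLink (π f) x y) {D : Set γ}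
    {K F : Graph α β} (hK : K ≤ H.restrict (Subtype.val '' (π '' (Subtype.val ⁻¹' D))))
    (hF : F ∈ 𝓕) (hne : F.edgeSet.Nonempty) (hKF : K.IsIsomorphicTo F) :
    (G.copyHypergraph 𝓕).ContainsEdge D := by
  have hlift (e : K.edgeSet) : ∃ f : G.edgeSet, (f : γ) ∈ D ∧ (π f : β) = e := by
    obtain ⟨x, y, h⟩ := exists_isLink_of_mem_edgeSet e.2
    obtain ⟨_, ⟨f, hf, rfl⟩, he⟩ := (h.mono hK).1
    exact ⟨f, hf, he⟩
  choose φ hφD hφ using hlift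
  have hinj : Function.Injective fun e => (φ e : γ) := by
    intro e e' h
    rw [Subtype.ext_iff, ← hφ e, ← hφ e', Subtype.ext h]
  refine ⟨(K.mapEdges _ hinj).edgeSet, ⟨?_, K.mapEdges _ hinj, ?_, ⟨F, hF, hKF.mapEdges⟩, rfl⟩, ?_⟩
  · obtain ⟨-, ψ, -⟩ := hKF
    obtain ⟨d, hd⟩ := hne
    rw [edgeSet_mapEdges]
    exact ⟨_, ψ.symm ⟨d, hd⟩, rfl⟩
  · constructor
    · rw [hV]
      exact IsSubgraph.vertexSet_mono (hK.trans restrict_le)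
    · rintro _ x y ⟨e, rfl, h⟩
      rw [hπ, hφ]
      exact h.mono (hK.trans restrict_le)
  · rw [edgeSet_mapEdges]
    rintro _ ⟨e, rfl⟩
    exact hφD e

/-- A set of edges containing no copy projects to an `𝓕`-free subgraph. -/
theorem ncard_image_le_turanNumber (hHfin : H.edgeSet.Finite) (hV : G.vertexSet = H.vertexSet)
    (hπ : ∀ (f : G.edgeSet) x y, G.IsLink f x y ↔ H.IsLink (π f) x y) (hne : ∀ F ∈ 𝓕, F.edgeSet.Nonempty)
    {D : Set γ} (hD : ¬ (G.copyHypergraph 𝓕).ContainsEdge D) :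
    (π '' (Subtype.val ⁻¹' D)).ncard ≤ H.turanNumber 𝓕 := by
  set A := π '' (Subtype.val ⁻¹' D) with hA
  have hcard : A.ncard = (H.restrict (Subtype.val '' A)).edgeSet.ncard := by
    have : (H.restrict (Subtype.val '' A)).edgeSet = Subtype.val '' A := by
      rw [restrict]
      exact Set.inter_eq_right.2 (by rintro _ ⟨e, -, rfl⟩; exact e.2)
    rw [this, Set.ncard_image_of_injective _ Subtype.val_injective]
  rw [hcard]
  refine le_turanNumber hHfin (restrict_isSpanningSubgraph _ _) fun K hK F hF hKF => hD <|
    containsEdge_of_le_restrict_image hV hπ hK hF (hne F hF) hKF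

/-- The preimage of an `𝓕`-free spanning subgraph is `𝓕`-free. -/
theorem isFreeOf_restrict_preimage (hV : G.vertexSet = H.vertexSet)
    (hπ : ∀ (f : G.edgeSet) x y, G.IsLink f x y ↔ H.IsLink (π f) x y) (hsimple : ∀ F ∈ 𝓕, F.Simple)
    {T : Graph α β} (hT : T ≤s H) (hfree : T.IsFreeOf 𝓕) :
    (G.restrict (Subtype.val '' {f | (π f : β) ∈ T.edgeSet})).IsFreeOf 𝓕 := by
  intro K hK F hF hKF
  have hKG : K ≤ G := hK.trans restrict_le
  have hmem (f : K.edgeSet) : (f : γ) ∈ G.edgeSet := IsSubgraph.edgeSet_mono hKG f.2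
  let φ : K.edgeSet → β := fun f => π ⟨f, hmem f⟩
  have hφ (f : K.edgeSet) : φ f ∈ T.edgeSet := by
    obtain ⟨x, y, h⟩ := exists_isLink_of_mem_edgeSet f.2
    obtain ⟨f', hf', he⟩ := (h.mono hK).1
    have : f' = ⟨f, hmem f⟩ := Subtype.ext he
    change (π ⟨f, hmem f⟩ : β) ∈ T.edgeSet
    rw [← this]
    exact hf'
  have hφH {f : K.edgeSet} {x y : α} : K.IsLink f x y ↔ H.IsLink (φ f) x y :=
    (hKG.isLink_iff f.2).trans (hπ ⟨f, hmem f⟩ x y)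
  -- Two edges of the copy with the same projection would be parallel, but members of `𝓕` are
  -- simple.
  have hinj : Function.Injective φ := by
    obtain ⟨g, ψ, hψ⟩ := hKF
    intro f f' h
    obtain ⟨x, y, hxy⟩ := exists_isLink_of_mem_edgeSet f.2
    have hxy' : K.IsLink f' x y := hφH.2 (h ▸ hφH.1 hxy)
    have h1 := (hψ f ⟨x, hxy.left_mem⟩ ⟨y, hxy.right_mem⟩).1 hxy
    have h2 := (hψ f' ⟨x, hxy.left_mem⟩ ⟨y, hxy.right_mem⟩).1 hxy'
    exact ψ.injective (Subtype.ext ((hsimple F hF).eq_of_isLink h1 h2))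
  refine hfree (K.mapEdges φ hinj) ⟨?_, ?_⟩ F hF hKF.mapEdges
  · rw [hT.vertexSet_eq, ← hV]
    exact IsSubgraph.vertexSet_mono hKG
  · rintro _ x y ⟨f, rfl, h⟩
    exact (hT.le.isLink_iff (hφ f)).2 (hφH.1 h)

/-- The preimage of `T` in `G` is free, and all its fibres have exactly `r` edges because `T` only
uses edges in `S`. -/
theorem IsMultiplied.mul_turanNumber_le (hG : G.IsMultiplied H S r) (hH : H.Simple)
    (hGfin : G.edgeSet.Finite) (hHfin : H.edgeSet.Finite)
    (hπ : ∀ (f : G.edgeSet) x y, G.IsLink f x y ↔ H.IsLink (π f) x y)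
    (hsimple : ∀ F ∈ 𝓕, F.Simple) {T : Graph α β} (hT : T ≤s H.restrict S)
    (hfree : T.IsFreeOf 𝓕) :
    r * T.edgeSet.ncard ≤ G.turanNumber 𝓕 := by
  classical
  have hTH : T ≤s H := hT.trans (restrict_isSpanningSubgraph _ _)
  have hTS (e : β) (he : e ∈ T.edgeSet) : e ∈ S := (IsSubgraph.edgeSet_mono hT.le he).2
  refine le_trans (le_of_eq ?_) (le_turanNumber hGfin (restrict_isSpanningSubgraph _ _)
    (isFreeOf_restrict_preimage hG.vertexSet_eq hπ hsimple hTH hfree))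
  have h1 : (G.restrict (Subtype.val '' {f | (π f : β) ∈ T.edgeSet})).edgeSet =
      Subtype.val '' {f | (π f : β) ∈ T.edgeSet} := by
    rw [restrict]
    exact Set.inter_eq_right.2 (by rintro _ ⟨e, -, rfl⟩; exact e.2)
  have := hGfin.fintype
  have := hHfin.fintype
  rw [h1, Set.ncard_image_of_injective _ Subtype.val_injective]
  have h2 : T.edgeSet = Subtype.val '' {e : H.edgeSet | (e : β) ∈ T.edgeSet} := by
    exact ((Subtype.image_preimage_coe H.edgeSet T.edgeSet).trans
      (Set.inter_eq_right.2 (IsSubgraph.edgeSet_mono hTH.le))).symm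
  rw [h2, Set.ncard_image_of_injective _ Subtype.val_injective, ← h2,
    Set.ncard_eq_toFinset_card', Set.ncard_eq_toFinset_card',
    Finset.card_eq_sum_card_fiberwise (f := π)
      (t := {e : H.edgeSet | (e : β) ∈ T.edgeSet}.toFinset), Finset.sum_const_nat (m := r),
      mul_comm]
  · intro e he
    have he : (e : β) ∈ T.edgeSet := by simpa using he
    have := hG.encard_fiber_eq hH hπ (hTS e he)
    rw [Set.encard_eq_coe_toFinset_card] at this
    rw [← Nat.cast_inj (R := ℕ∞), ← this]
    congr 2
    ext f
    simp only [Finset.mem_filter, Set.mem_toFinset, Set.mem_ofPred_eq]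
    exact ⟨fun h => h.2, fun h => ⟨h ▸ he, h⟩⟩
  · intro f hf
    simpa using hf

/-- The edges of `G` can be ordered with parallel edges consecutive. -/
theorem exists_block_ordering (hGfin : G.edgeSet.Finite) (hHfin : H.edgeSet.Finite)
    (π : G.edgeSet → H.edgeSet) :
    ∃ σ : Fin G.edgeSet.ncard ≃ G.edgeSet,
      ∀ i l, π (σ i) = π (σ l) → ∀ k, i ≤ k → k ≤ l → π (σ k) = π (σ i) := by
  have := hGfin.to_subtype
  have := hHfin.to_subtype
  obtain ⟨ν⟩ : Nonempty (H.edgeSet ≃ Fin (Nat.card H.edgeSet)) := ⟨Finite.equivFin _⟩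
  obtain ⟨τ⟩ : Nonempty (Fin G.edgeSet.ncard ≃ G.edgeSet) :=
    ⟨(Finite.equivFinOfCardEq (Nat.card_coe_set_eq _)).symm⟩
  -- Sorting by an arbitrary numbering of the edges of `H` makes each fibre of `π` an interval.
  have hmono := Tuple.monotone_sort fun i => ν (π (τ i))
  refine ⟨(Tuple.sort fun i => ν (π (τ i))).trans τ, fun i l hil k hik hkl => ?_⟩
  refine ν.injective (le_antisymm ?_ (hmono hik))
  rw [hil]
  exact hmono hkl

end

end Graph

/-! ### Alternation bounds for block orderings -/

namespace Graph

section

variable {α β γ : Type*} {H : Graph α β} {G : Graph α γ} {π : G.edgeSet → H.edgeSet}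
  {𝓕 : Set (Graph α β)} {S : Set β} {r n m : ℕ}

open Classical in
theorem IsMultiplied.card_fiber_le (hG : G.IsMultiplied H S r) (hr : 1 ≤ r) (hH : H.Simple)
    (hπ : ∀ (f : G.edgeSet) x y, G.IsLink f x y ↔ H.IsLink (π f) x y) {q : Fin m → G.edgeSet}
    (hq : Function.Injective q) (e : H.edgeSet) :
    (Finset.univ.filter fun i => π (q i) = e).card ≤ r := by
  have h : (q '' {i | π (q i) = e}).encard ≤ {f | π f = e}.encard :=
    Set.encard_le_encard (by rintro _ ⟨i, hi, rfl⟩; exact hi)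
  rw [hq.encard_image, Set.encard_eq_coe_toFinset_card] at h
  have := h.trans (hG.encard_fiber_le hr hH hπ e).2
  rw [Nat.cast_le] at this
  convert this
  ext i
  simp

variable (hG : G.IsMultiplied H S r) (hr : 2 ≤ r) (hH : H.Simple) (hHfin : H.edgeSet.Finite)
  (hπ : ∀ (f : G.edgeSet) x y, G.IsLink f x y ↔ H.IsLink (π f) x y)
  (hne : ∀ F ∈ 𝓕, F.edgeSet.Nonempty) (σ : Fin n ≃ G.edgeSet)
  (hσ : ∀ i l, π (σ i) = π (σ l) → ∀ k, i ≤ k → k ≤ l → π (σ k) = π (σ i))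

include hG hr hH hHfin hπ hne hσ

/-- The blocks are the fibres of `π`. A sign class without a copy meets as many blocks as its
projection has edges, and that projection is free in `H`. -/
theorem IsMultiplied.altOrd_le :
    Hypergraph.altOrd (H := G.copyHypergraph 𝓕) σ ≤ r * H.turanNumber 𝓕 := by
  classical
  refine csSup_le' ?_
  rintro _ ⟨X, -, rfl, h1, h2⟩
  obtain ⟨j, hj⟩ := exists_isAlternating X
  have := hHfin.fintype
  have ha (s) (h : ¬ (G.copyHypergraph 𝓕).ContainsEdge
      (Hypergraph.signClass (H := G.copyHypergraph 𝓕) σ X s)) :=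
    ncard_image_le_turanNumber hHfin hG.vertexSet_eq hπ hne h
  simp only [Set.ncard_eq_toFinset_card'] at ha
  refine length_le_of_blocks (x := fun i => X (j i)) (p := fun i => π (σ (j i))) hj.2.1 hj.2.2
    (fun i l h k hik hkl => hσ _ _ h _ (hj.1.monotone hik) (hj.1.monotone hkl)) hr
    (hG.card_fiber_le (by omega) hH hπ (σ.injective.comp hj.1.injective)) ?_ ?_ (ha 1 h1)
    (ha (-1) h2)
  · intro i hi
    exact Set.mem_toFinset.2 ⟨σ (j i), ⟨j i, hi, rfl⟩, rfl⟩
  · intro i hi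
    exact Set.mem_toFinset.2 ⟨σ (j i), ⟨j i, hi, rfl⟩, rfl⟩

theorem IsMultiplied.saltOrd_le (heven : Even r) :
    Hypergraph.saltOrd (H := G.copyHypergraph 𝓕) σ ≤ r * H.turanNumber 𝓕 + 1 := by
  classical
  refine csSup_le' ?_
  rintro _ ⟨X, -, rfl, h⟩
  obtain ⟨j, hj⟩ := exists_isAlternating X
  have := hHfin.fintype
  obtain ⟨s, hs, h⟩ : ∃ s : SignType, s ≠ 0 ∧ ¬ (G.copyHypergraph 𝓕).ContainsEdge
      (Hypergraph.signClass (H := G.copyHypergraph 𝓕) σ X s) := by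
    rcases not_and_or.1 h with h | h
    · exact ⟨1, by decide, h⟩
    · exact ⟨-1, by decide, h⟩
  have ha := ncard_image_le_turanNumber hHfin hG.vertexSet_eq hπ hne h
  rw [Set.ncard_eq_toFinset_card'] at ha
  refine length_le_of_blocks_of_even (x := fun i => X (j i)) (p := fun i => π (σ (j i))) s hs
    hj.2.1 hj.2.2
    (fun i l h k hik hkl => hσ _ _ h _ (hj.1.monotone hik) (hj.1.monotone hkl)) heven
    (hG.card_fiber_le (by omega) hH hπ (σ.injective.comp hj.1.injective)) ?_ ha
  intro i hi
  exact Set.mem_toFinset.2 ⟨σ (j i), ⟨j i, hi, rfl⟩, rfl⟩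

end

theorem IsMultiplied.nonempty_copyHypergraph_edgeSet {α β γ : Type*} {H : Graph α β}
    {G : Graph α γ} {𝓕 : Set (Graph α β)} {S : Set β} {r : ℕ} (hG : G.IsMultiplied H S r)
    (hr : 1 ≤ r) (hH : H.Simple) {π : G.edgeSet → H.edgeSet}
    (hπ : ∀ (f : G.edgeSet) x y, G.IsLink f x y ↔ H.IsLink (π f) x y) {F : Graph α β}
    (hF : F ∈ 𝓕) (hFH : F ≤ H) (hne : F.edgeSet.Nonempty) :
    Nonempty (G.copyHypergraph 𝓕).edgeSet := by
  have hle : F ≤ H.restrict (Subtype.val '' (π '' (Subtype.val ⁻¹' Set.univ))) := by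
    refine ⟨(hFH.vertexSet_mono : F.vertexSet ⊆ H.vertexSet), fun e x y h => ⟨?_, h.mono hFH⟩⟩
    have he : e ∈ H.edgeSet := (h.mono hFH).edge_mem
    obtain ⟨f, hf⟩ := Set.one_le_encard_iff_nonempty.1 (hG.encard_fiber_le hr hH hπ ⟨e, he⟩).1
    exact ⟨⟨e, he⟩, ⟨f, trivial, hf⟩, rfl⟩
  obtain ⟨A, hA, -⟩ :=
    containsEdge_of_le_restrict_image hG.vertexSet_eq hπ hle hF hne (IsIsomorphicTo.refl F)
  exact ⟨⟨A, hA⟩⟩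

/-- An edgeless `F` would be a subgraph of every spanning subgraph of `H`, in particular of `T`. -/
theorem IsFreeOf.edgeSet_nonempty {α β : Type*} {H T F : Graph α β} {𝓕 : Set (Graph α β)}
    (hfree : T.IsFreeOf 𝓕) (hV : T.vertexSet = H.vertexSet) (hF : F ∈ 𝓕) (hFH : F ≤ H) :
    F.edgeSet.Nonempty := by
  by_contra h
  refine hfree F ⟨hV ▸ IsSubgraph.vertexSet_mono hFH, fun e x y hxy => ?_⟩ F hF
    (IsIsomorphicTo.refl F)
  exact absurd ⟨e, hxy.edge_mem⟩ h

end Graph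

/-! ### The theorem -/

theorem mainTheorem2 {α β γ : Type*}
    (H : Graph α β) (hH : H.Simple) (hfin : H.vertexSet.Finite)
    (𝓕 : Set (Graph α β)) (h𝓕 : ∀ F ∈ 𝓕, F ≤ H)
    (r : ℕ) (hr : 2 ≤ r) (S : Set β)
    (G : Graph α γ) (hG : G.IsMultiplied H S r)
    (hS : ∃ T : Graph α β, T ≤s H.restrict S ∧ T.IsFreeOf 𝓕 ∧
      T.edgeSet.ncard = H.turanNumber 𝓕) :
    ((G.kneserGraphOf 𝓕).chromaticNumber = (G.kneserGraphOf 𝓕).altermaticNumber ∧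
      (G.kneserGraphOf 𝓕).chromaticNumber =
        ((G.edgeSet.ncard - G.turanNumber 𝓕 : ℕ) : ℕ∞)) ∧
    (Even r → 𝓕.Nonempty →
      (G.kneserGraphOf 𝓕).chromaticNumber = (G.kneserGraphOf 𝓕).strongAltermaticNumber) := by
  obtain ⟨T, hT, hfree, hcard⟩ := hS
  have hTH : T ≤s H := hT.trans (Graph.restrict_isSpanningSubgraph _ _)
  have hne : ∀ F ∈ 𝓕, F.edgeSet.Nonempty := fun F hF =>
    hfree.edgeSet_nonempty hTH.vertexSet_eq hF (h𝓕 F hF)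
  have hsimple : ∀ F ∈ 𝓕, F.Simple := fun F hF => hH.anti (h𝓕 F hF)
  obtain ⟨π, hπ⟩ := hG.exists_projection
  have hHfin := Graph.finite_edgeSet_of_finite_vertexSet hH hfin
  have hGfin := hG.finite_edgeSet (by omega) hH hfin hπ
  obtain ⟨σ, hσ⟩ := Graph.exists_block_ordering hGfin hHfin π
  have hex : r * H.turanNumber 𝓕 ≤ G.turanNumber 𝓕 :=
    hcard ▸ hG.mul_turanNumber_le hH hGfin hHfin hπ hsimple hT hfree
  have hupper := Graph.chromaticNumber_kneserGraphOf_le hGfin ⟨_,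
    Graph.restrict_isSpanningSubgraph _ _,
    Graph.isFreeOf_restrict_preimage hG.vertexSet_eq hπ hsimple hTH hfree⟩
  refine ⟨?_, fun heven hnonempty => ?_⟩
  · have h1 := hG.altOrd_le hr hH hHfin hπ hne σ hσ
    have h2 := Hypergraph.card_sub_altOrd_le_altermaticNumber (K := G.copyHypergraph 𝓕) σ
      Graph.empty_notMem_copyHypergraph
    have h3 := (G.kneserGraphOf 𝓕).altermaticNumber_le_chromaticNumber
    have h4 : ((G.edgeSet.ncard - G.turanNumber 𝓕 : ℕ) : ℕ∞) ≤
        (G.kneserGraphOf 𝓕).altermaticNumber :=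
      le_trans (by exact_mod_cast Nat.sub_le_sub_left (h1.trans hex) _) h2
    exact ⟨le_antisymm (hupper.trans h4) h3, le_antisymm hupper (h4.trans h3)⟩
  · obtain ⟨F, hF⟩ := hnonempty
    have := hG.nonempty_copyHypergraph_edgeSet (by omega) hH hπ hF (h𝓕 F hF) (hne F hF)
    have h1 := hG.saltOrd_le hr hH hHfin hπ hne σ hσ heven
    have h2 := Hypergraph.card_sub_saltOrd_le_strongAltermaticNumber (K := G.copyHypergraph 𝓕) σ
      Graph.empty_notMem_copyHypergraph
    refine le_antisymm (hupper.trans (le_trans ?_ h2))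
      (G.kneserGraphOf 𝓕).strongAltermaticNumber_le_chromaticNumber
    -- The extra `1` in the bound on `saltOrd` is absorbed by the `+ 1` in the definition of the
    -- strong altermatic number.
    exact_mod_cast (by omega : G.edgeSet.ncard - G.turanNumber 𝓕 ≤
      G.edgeSet.ncard + 1 - Hypergraph.saltOrd (H := G.copyHypergraph 𝓕) σ)
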